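/- Let $t$ be an indeterminate and let $A=\mathbb{Q}(t)[x_1,x_2,\dots,y_1,y_2,\dots]$. For a sequence $\mathbf a=(a_1,a_2,\dots)$ in a $\mathbb{Q}(t)$-algebra put $\xi_t(\mathbf a,z)=\sum_{n\ge1}(1-t^n)a_nz^n$, and define $q_n(\mathbf x),q_n(\mathbf y)\in A$ by $\sum_{n\ge0}q_n(\mathbf x)z^n=e^{\xi_t(\mathbf x,z)}$, $\sum_{n\ge0}q_n(\mathbf y)z^n=e^{\xi_t(\mathbf y,z)}$, with $q_n=0$ for $n<0$. For integer sequences $\alpha=(\alpha_1,\dots,\alpha_l)$ and $\beta=(\beta_1,\dots,\beta_{l'})$ put $q_{[\alpha,\beta]}=\prod_i q_{\alpha_i}(\mathbf x)\prod_a q_{\beta_a}(\mathbf y)$. For Young diagrams $\lambda=(\lambda_1,\dots,\lambda_l)$ and $\mu=(\mu_1,\dots,\mu_{l'})$ with $l$ and $l'$ rows, the coupled Hall--Littlewood function is $$Q_{[\lambda,\mu]}=\prod_{i<j}\frac{1-R_{\lambda_i\lambda_j}}{1-tR_{\lambda_i\lambda_j}}\prod_{a<b}\frac{1-R_{\mu_a\mu_b}}{1-tR_{\mu_a\mu_b}}\prod_{i,a}\frac{(1-D_{\lambda_i\mu_a})(1-t^2D_{\lambda_i\mu_a})}{(1-tD_{\lambda_i\mu_a})^2}\;q_{[\lambda,\mu]}\in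 A,$$ where the operators act on the pair of index sequences: $R_{\lambda_i\lambda_j}$ adds $1$ to the $i$-th entry and subtracts $1$ from the $j$-th entry of the first sequence, $R_{\mu_a\mu_b}$ does the same in the second sequence, and $D_{\lambda_i\mu_a}$ subtracts $1$ from the $i$-th entry of the first and from the $a$-th entry of the second sequence. All factors are expanded in nonnegative powers of the operators, their product is expanded, and each resulting monomial in the operators is applied to the index pair $(\lambda,\mu)$ before $q_{[\cdot,\cdot]}$ is evaluated; only finitely many terms are nonzero. Let $\Gamma_1^-(z)=\exp\xi_t(\mathbf x-\tilde\partial_{\mathbf y},z)$ and $\Gamma_2^-(z)=\exp\xi_t(\mathbf y-\tilde\partial_{\mathbf x},z)$, where $\mathbf x-\tilde\partial_{\mathbf y}=(x_n-\tfrac1n\partial_{y_n})_{n\ge1}$ and $\mathbf y-\tilde\partial_{\mathbf x}=(y_n-\tfrac1n\partial_{x_n})_{n\ge1}$ are sequences of operators on $A$; thus $\Gamma_1^-(z)$ and $\Gamma_2^-(z)$ are power series in $z$ with coefficients in $\mathrm{End}_{\mathbb{Q}(t)}(A)$ and map $A$ to $A[[z]]$. Write $\nu\succ\lambda$ if $\nu_1\ge\lambda_1\ge\nu_2\ge\lambda_2\ge\cdots$.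 In that case, with $\theta'_j$ the number of boxes of $\nu-\lambda$ in column $j$ and $m_j(\lambda)$ the number of parts of $\lambda$ equal to $j$, let $$P_{\nu/\lambda}(z,t)=\psi_{\nu/\lambda}(t)\,z^{|\nu|-|\lambda|},\qquad \psi_{\nu/\lambda}(t)=\prod_{j\ge1,\ \theta'_j<\theta'_{j+1}}\bigl(1-t^{m_j(\lambda)}\bigr).$$ Then for all Young diagrams $\lambda,\mu$, $$\Gamma_1^-(z)\,Q_{[\lambda,\mu]}=\sum_{\nu\succ\lambda}P_{\nu/\lambda}(z,t)\,Q_{[\nu,\mu]},\qquad \Gamma_2^-(z)\,Q_{[\lambda,\mu]}=\sum_{\nu\succ\mu}P_{\nu/\mu}(z,t)\,Q_{[\lambda,\nu]}$$ in $A[[z]]$, the sums being over all Young diagrams $\nu$ with the stated interlacing property; for each $n$ only finitely many $\nu$ contribute to the coefficient of $z^n$. -/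

import Mathlib

open scoped PowerSeries

noncomputable section

namespace CoupledHL

/-- The field of scalars `ℚ(t)`. -/
abbrev K : Type := RatFunc ℚ

/-- The indeterminate `t` of `ℚ(t)`. -/
def t : K := RatFunc.X

/-- The polynomial ring `ℚ(t)[x₁, x₂, …, y₁, y₂, …]`. -/
abbrev A : Type := MvPolynomial (ℕ+ ⊕ ℕ+) K

/-- The variable `xₙ`. -/
def x (n : ℕ+) : A := MvPolynomial.X (Sum.inl n)

/-- The variable `yₙ`. -/
def y (n : ℕ+) : A := MvPolynomial.X (Sum.inr n)

section Series

variable {R : Type*} [Ring R] [Algebra K R]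

/-- The series `ξ_t(a, z) = ∑_{n ≥ 1} (1 - tⁿ) aₙ zⁿ` in `R⟦z⟧`, for a sequence `a₁, a₂, …` in a
`ℚ(t)`-algebra `R`, commutative or not. -/
def xi (a : ℕ+ → R) : R⟦X⟧ :=
  PowerSeries.mk fun n => if h : 0 < n then (1 - t ^ n) • a ⟨n, h⟩ else 0

/-- The exponential `∑ₖ fᵏ / k!` of a power series `f` with zero constant term. As `fᵏ` is divisible
by `zᵏ`, only the terms with `k ≤ n` contribute to the coefficient of `zⁿ`. -/
def expSeries (f : R⟦X⟧) : R⟦X⟧ :=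
  PowerSeries.mk fun n =>
    ∑ k ∈ Finset.range (n + 1), ((k.factorial : K)⁻¹) • PowerSeries.coeff n (f ^ k)

/-- `qₙ(a)`, the coefficient of `zⁿ` in `exp ξ_t(a, z)`, and `0` for `n < 0`. -/
def q (a : ℕ+ → R) (n : ℤ) : R :=
  if n < 0 then 0 else PowerSeries.coeff n.toNat (expSeries (xi a))

end Series

/-- `q_{[α,β]}(x, y) = ∏ᵢ q_{αᵢ}(x) ∏ₐ q_{βₐ}(y)` for integer sequences `α`, `β`. -/
def qPair {l l' : ℕ} (α : Fin l → ℤ) (β : Fin l' → ℤ) : A :=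
  (∏ i, q x (α i)) * ∏ a, q y (β a)

/-- The coefficient of `Rᵏ` in the expansion of `(1 - R) / (1 - t R)`. -/
def raiseCoeff (k : ℕ) : K :=
  PowerSeries.coeff k ((1 - PowerSeries.X) * (1 - PowerSeries.C t * PowerSeries.X)⁻¹ : K⟦X⟧)

/-- The coefficient of `Dᵏ` in the expansion of
`(1 - D) / (1 - t D) * (1 - t² D) / (1 - t D)`. -/
def lowerCoeff (k : ℕ) : K :=
  PowerSeries.coeff k
    ((1 - PowerSeries.X) * (1 - PowerSeries.C t * PowerSeries.X)⁻¹ *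
      ((1 - PowerSeries.C (t ^ 2) * PowerSeries.X) *
        (1 - PowerSeries.C t * PowerSeries.X)⁻¹) : K⟦X⟧)

/-- The pairs `i < j` of indices. -/
abbrev Pairs (l : ℕ) : Type := {p : Fin l × Fin l // p.1 < p.2}

/-- The rows `(λ₁, …, λ_l)` of a Young diagram, where `l` is its number of rows. -/
def rows (lam : YoungDiagram) : Fin (lam.colLen 0) → ℤ := fun i => (lam.rowLen i : ℤ)

/-- The effect of `∏_{i<j} R_{ij}^{k_{ij}}` on an index sequence: `R_{ij}` adds `1` to the `i`-th
entry and subtracts `1` from the `j`-th. -/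
def raise {l : ℕ} (k : Pairs l → ℕ) (α : Fin l → ℤ) : Fin l → ℤ :=
  α + ∑ p, (k p : ℤ) • (Pi.single p.1.1 1 - Pi.single p.1.2 1 : Fin l → ℤ)

/-- The effect of `∏_{i,a} D_{ia}^{d_{ia}}` on the first index sequence. -/
def lowerLeft {l l' : ℕ} (d : Fin l × Fin l' → ℕ) (α : Fin l → ℤ) : Fin l → ℤ :=
  α - ∑ p, (d p : ℤ) • (Pi.single p.1 1 : Fin l → ℤ)

/-- The effect of `∏_{i,a} D_{ia}^{d_{ia}}` on the second index sequence. -/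
def lowerRight {l l' : ℕ} (d : Fin l × Fin l' → ℕ) (β : Fin l' → ℤ) : Fin l' → ℤ :=
  β - ∑ p, (d p : ℤ) • (Pi.single p.2 1 : Fin l' → ℤ)

/-- The term of the expanded raising operator formula with exponents `k` of the `R_{λᵢλⱼ}`, `m` of
the `R_{μₐμ_b}` and `d` of the `D_{λᵢμₐ}`. -/
def term {l l' : ℕ} (α : Fin l → ℤ) (β : Fin l' → ℤ)
    (e : (Pairs l → ℕ) × (Pairs l' → ℕ) × (Fin l × Fin l' → ℕ)) : A :=
  ((∏ p, raiseCoeff (e.1 p)) * (∏ p, raiseCoeff (e.2.1 p)) * ∏ p, lowerCoeff (e.2.2 p)) •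
    qPair (lowerLeft e.2.2 (raise e.1 α)) (lowerRight e.2.2 (raise e.2.1 β))

theorem weight_bound {l l' : ℕ} (α : Fin l → ℤ) (k : Pairs l → ℕ) (d : Fin l × Fin l' → ℕ)
    (h : ∀ i, 0 ≤ lowerLeft d (raise k α) i) :
    (∑ p, (k p : ℤ)) + ∑ p, (d p : ℤ) ≤ ∑ i : Fin l, (((i : ℕ) : ℤ) + 1) * α i := by
  let W : (Fin l → ℤ) →ₗ[ℤ] ℤ := ∑ i : Fin l, (((i : ℕ) : ℤ) + 1) • LinearMap.proj i
  have hW : ∀ v, W v = ∑ i : Fin l, (((i : ℕ) : ℤ) + 1) * v i := by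
    intro v
    simp [W]
  have hs : ∀ i : Fin l, W (Pi.single i 1) = ((i : ℕ) : ℤ) + 1 := by
    intro i
    rw [hW, Finset.sum_eq_single i] <;> simp +contextual
  have h0 : 0 ≤ W (lowerLeft d (raise k α)) := by
    rw [hW]
    exact Finset.sum_nonneg fun i _ => mul_nonneg (by positivity) (h i)
  simp only [lowerLeft, raise, map_sub, map_add, map_sum, map_smul, hs, smul_eq_mul] at h0
  have h2 : ∑ p : Pairs l, (k p : ℤ) * ((((p.1.1 : ℕ) : ℤ) + 1) - (((p.1.2 : ℕ) : ℤ) + 1)) ≤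
      ∑ p : Pairs l, -(k p : ℤ) := by
    refine Finset.sum_le_sum fun p _ => ?_
    have h3 : (p.1.1 : ℕ) < (p.1.2 : ℕ) := p.2
    have h5 : (((p.1.1 : ℕ) : ℤ) + 1) - (((p.1.2 : ℕ) : ℤ) + 1) ≤ -1 := by omega
    nlinarith [Int.natCast_nonneg (k p)]
  have h4 : ∑ p : Fin l × Fin l', (d p : ℤ) ≤
      ∑ p : Fin l × Fin l', (d p : ℤ) * (((p.1 : ℕ) : ℤ) + 1) := by
    refine Finset.sum_le_sum fun p _ => ?_
    nlinarith [Int.natCast_nonneg (d p), Int.natCast_nonneg (p.1 : ℕ),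
      mul_nonneg (Int.natCast_nonneg (d p)) (Int.natCast_nonneg (p.1 : ℕ))]
  rw [Finset.sum_neg_distrib] at h2
  rw [← hW]
  linarith

theorem q_of_neg {R : Type*} [Ring R] [Algebra K R] (a : ℕ+ → R) {n : ℤ} (hn : n < 0) :
    q a n = 0 := by
  simp [q, hn]

theorem term_support_finite {l l' : ℕ} (α : Fin l → ℤ) (β : Fin l' → ℤ) :
    (Function.support (term α β)).Finite := by
  classical
  let N : ℕ := (∑ i : Fin l, (((i : ℕ) : ℤ) + 1) * α i).toNat
  let M : ℕ := (∑ i : Fin l', (((i : ℕ) : ℤ) + 1) * β i).toNat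
  refine (Set.finite_Icc 0 ((fun _ => N, fun _ => M, fun _ => N) :
    (Pairs l → ℕ) × (Pairs l' → ℕ) × (Fin l × Fin l' → ℕ))).subset ?_
  rintro ⟨k, m, d⟩ he
  have hq : qPair (lowerLeft d (raise k α)) (lowerRight d (raise m β)) ≠ 0 := by
    intro h
    exact he (by simp [term, h])
  have hα : ∀ i, 0 ≤ lowerLeft d (raise k α) i := by
    intro i
    by_contra! hi
    exact hq (by rw [qPair, Finset.prod_eq_zero (Finset.mem_univ i) (q_of_neg x hi), zero_mul])
  have hβ : ∀ i, 0 ≤ lowerRight d (raise m β) i := by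
    intro i
    by_contra! hi
    exact hq (by rw [qPair, Finset.prod_eq_zero (Finset.mem_univ i) (q_of_neg y hi), mul_zero])
  have hβ' : ∀ i, 0 ≤ lowerLeft (d ∘ Prod.swap) (raise m β) i := by
    intro i
    have h := hβ i
    have hsum : ∑ p : Fin l' × Fin l, ((d ∘ Prod.swap) p : ℤ) • (Pi.single p.1 1 : Fin l' → ℤ) =
        ∑ p : Fin l × Fin l', (d p : ℤ) • (Pi.single p.2 1 : Fin l' → ℤ) :=
      Fintype.sum_equiv (Equiv.prodComm _ _) _ _ (fun p => rfl)
    rw [lowerLeft, hsum]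
    exact h
  have h1 := weight_bound α k d hα
  have h2 := weight_bound β m (d ∘ Prod.swap) hβ'
  have hd' : (0 : ℤ) ≤ ∑ p, ((d ∘ Prod.swap) p : ℤ) := Finset.sum_nonneg fun p _ => by positivity
  have hd : (0 : ℤ) ≤ ∑ p, (d p : ℤ) := Finset.sum_nonneg fun p _ => by positivity
  have hk : (0 : ℤ) ≤ ∑ p, (k p : ℤ) := Finset.sum_nonneg fun p _ => by positivity
  have h0 : (0 : (Pairs l → ℕ) × (Pairs l' → ℕ) × (Fin l × Fin l' → ℕ)) ≤ (k, m, d) :=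
    ⟨fun _ => Nat.zero_le _, fun _ => Nat.zero_le _, fun _ => Nat.zero_le _⟩
  refine Set.mem_Icc.2
    ⟨h0, Prod.mk_le_mk.2 ⟨fun p => ?_, Prod.mk_le_mk.2 ⟨fun p => ?_, fun p => ?_⟩⟩⟩
  · have := Finset.single_le_sum (f := fun p => (k p : ℤ)) (fun p _ => by positivity)
      (Finset.mem_univ p)
    show k p ≤ N
    omega
  · have := Finset.single_le_sum (f := fun p => (m p : ℤ)) (fun p _ => by positivity)
      (Finset.mem_univ p)
    show m p ≤ M
    omega
  · have := Finset.single_le_sum (f := fun p => (d p : ℤ)) (fun p _ => by positivity)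
      (Finset.mem_univ p)
    show d p ≤ N
    omega

/-- The coupled Hall-Littlewood function
`Q_{[λ,μ]} = ∏_{i<j} (1-R_{λᵢλⱼ})/(1-tR_{λᵢλⱼ}) ∏_{a<b} (1-R_{μₐμ_b})/(1-tR_{μₐμ_b})
  ∏_{i,a} (1-D_{λᵢμₐ})(1-t²D_{λᵢμₐ})/(1-tD_{λᵢμₐ})² q_{[λ,μ]}`,
every factor being expanded in nonnegative powers of its operator. Only finitely many terms are
nonzero, see `term_support_finite`. -/
def Q (lam mu : YoungDiagram) : A :=
  ∑ᶠ e, term (rows lam) (rows mu) e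

/-- The operator `xₙ - (1/n) ∂/∂yₙ` on `ℚ(t)[x, y]`. -/
def xOp (n : ℕ+) : Module.End K A :=
  LinearMap.mulLeft K (x n) - ((n : ℕ) : K)⁻¹ • (MvPolynomial.pderiv (Sum.inr n)).toLinearMap

/-- The operator `yₙ - (1/n) ∂/∂xₙ` on `ℚ(t)[x, y]`. -/
def yOp (n : ℕ+) : Module.End K A :=
  LinearMap.mulLeft K (y n) - ((n : ℕ) : K)⁻¹ • (MvPolynomial.pderiv (Sum.inl n)).toLinearMap

/-- The vertex operator `Γ₁⁻(z) = exp ξ_t(x - ∂̃_y, z)`, a power series in `z` whose coefficients are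
operators on `ℚ(t)[x, y]`. -/
def Gamma1 : (Module.End K A)⟦X⟧ := expSeries (xi xOp)

/-- The vertex operator `Γ₂⁻(z) = exp ξ_t(y - ∂̃_x, z)`. -/
def Gamma2 : (Module.End K A)⟦X⟧ := expSeries (xi yOp)

/-- Action of a power series of operators on a polynomial, coefficient by coefficient. -/
def act (G : (Module.End K A)⟦X⟧) (f : A) : A⟦X⟧ :=
  PowerSeries.mk fun n => (PowerSeries.coeff n G) f

/-- Interlacing `ν ≻ λ`, that is `ν₁ ≥ λ₁ ≥ ν₂ ≥ λ₂ ≥ ⋯`. -/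
def Interlaces (nu lam : YoungDiagram) : Prop :=
  ∀ i, lam.rowLen i ≤ nu.rowLen i ∧ nu.rowLen (i + 1) ≤ lam.rowLen i

/-- `θ'ⱼ`, the number of boxes of `ν - λ` in the `j`-th column, for `j ≥ 1`. -/
def skewCol (nu lam : YoungDiagram) (j : ℕ) : ℤ :=
  (nu.colLen (j - 1) : ℤ) - (lam.colLen (j - 1) : ℤ)

/-- The set `J_{ν/λ}` of the `j ≥ 1` with `θ'ⱼ < θ'ⱼ₊₁`; such a `j` is less than `ν₁`
when `λ ⊆ ν`. -/
def J (nu lam : YoungDiagram) : Finset ℕ :=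
  {j ∈ Finset.Icc 1 (nu.rowLen 0) | skewCol nu lam j < skewCol nu lam (j + 1)}

/-- `ψ_{ν/λ}(t) = ∏_{j ∈ J_{ν/λ}} (1 - t^{m_j(λ)})`, where `m_j(λ)` is the number of parts of `λ`
equal to `j`. -/
def psi (nu lam : YoungDiagram) : K :=
  ∏ j ∈ J nu lam, (1 - t ^ (lam.rowLens.count j))

open Classical in
/-- The one-variable skew Hall-Littlewood function `P_{ν/λ}(z, t)`, as a polynomial in `z`. -/
def P (nu lam : YoungDiagram) : Polynomial K :=
  if Interlaces nu lam then Polynomial.monomial (nu.card - lam.card) (psi nu lam) else 0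

/-- The product of a polynomial in `z` over `ℚ(t)` and an element of `ℚ(t)[x, y]`, in
`ℚ(t)[x, y]⟦z⟧`. -/
def scale (p : Polynomial K) (f : A) : A⟦X⟧ :=
  ((p.map (algebraMap K A) : Polynomial A) : A⟦X⟧) * PowerSeries.C f

/-- `g` is the sum of the family `f` of formal power series: for each `n` only finitely many members
contribute to the coefficient of `zⁿ`, and their contributions add up to the one of `g`. -/
def IsFormalSum {ι : Type*} (f : ι → A⟦X⟧) (g : A⟦X⟧) : Prop :=
  ∀ n, (Function.support fun i => PowerSeries.coeff n (f i)).Finite ∧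
    PowerSeries.coeff n g = ∑ᶠ i, PowerSeries.coeff n (f i)

end CoupledHL

end

/-!
Let `hₘ` be the coefficient of `zᵐ` in `Γ₁⁻(z)`, and let `Bₙ = ∑ₖ hₙ₊ₖ ∘ Tₖ`, where `Tₖ` is the
coefficient of `uᵏ` in the translation `xᵢ ↦ xᵢ - uⁱ / i`. Moving `Tₖ` past multiplication by
`qₘ(x)`, and the part of `hₘ` that contains `∂_y` past multiplication by `qₘ(y)`, produces exactly
the raising and lowering factors of a new first index `n`. Hence `Bₙ` prepends the part `n`, and
`Q_{[λ,μ]} = B_{λ₁} B_{λ₂} ⋯ Q_{[∅,μ]}`.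

These operators satisfy
`Bₙ hₘ - t Bₙ₊₁ hₘ₋₁ = hₘ Bₙ - hₘ₋₁ Bₙ₊₁` and
`Bₙ Bᵣ - t Bₙ₊₁ Bᵣ₋₁ = t Bᵣ Bₙ - Bᵣ₋₁ Bₙ₊₁`.
As `hₘ` acts on `Q_{[∅,μ]}` in the same way as `Bₘ`, the first relation lets `hₘ` travel through
`B_{λ₁} B_{λ₂} ⋯` from the left, and the second one reorders the resulting words into partitions.
The coefficients that arise obey a recursion in the number of rows, which `ψ_{ν/λ}` satisfies as
well. The formula for `Γ₂⁻` follows from the one for `Γ₁⁻` by exchanging the variables `x` and `y`.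
-/

open scoped PowerSeries

noncomputable section

namespace CoupledHL

/-! ### Exponential series -/

section Coefficients

open PowerSeries

variable {R S : Type*} [Ring R] [Algebra K R] [Ring S] [Algebra K S]

theorem map_xi (φ : R →ₐ[K] S) (a : ℕ+ → R) :
    PowerSeries.map (φ : R →+* S) (xi a) = xi fun n => φ (a n) := by
  ext n
  simp only [xi, coeff_map, coeff_mk]
  split_ifs <;> simp

theorem map_expSeries (φ : R →ₐ[K] S) (f : R⟦X⟧) :
    PowerSeries.map (φ : R →+* S) (expSeries f) =
      expSeries (PowerSeries.map (φ : R →+* S) f) := by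
  ext n
  simp [expSeries, ← map_pow]

theorem map_q (φ : R →ₐ[K] S) (a : ℕ+ → R) (n : ℤ) :
    φ (q a n) = q (fun k => φ (a k)) n := by
  unfold q
  split_ifs
  · exact map_zero φ
  · rw [← map_xi, ← map_expSeries, coeff_map]
    rfl

theorem q_natCast (a : ℕ+ → R) (n : ℕ) : q a (n : ℤ) = coeff n (expSeries (xi a)) := by
  simp [q]

theorem coeff_xi_succ (a : ℕ+ → R) (n : ℕ) :
    coeff (n + 1) (xi a) = (1 - t ^ (n + 1)) • a n.succPNat := by
  rw [xi, coeff_mk, dif_pos n.succ_pos]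
  rfl

theorem constantCoeff_xi (a : ℕ+ → R) : constantCoeff (xi a) = 0 := by
  simp [xi]

theorem constantCoeff_expSeries (f : R⟦X⟧) : constantCoeff (expSeries f) = 1 := by
  rw [← coeff_zero_eq_constantCoeff_apply]
  simp [expSeries]

theorem q_zero (a : ℕ+ → R) : q a 0 = 1 := by
  rw [← Nat.cast_zero, q_natCast, coeff_zero_eq_constantCoeff_apply, constantCoeff_expSeries]

theorem xi_add (a b : ℕ+ → R) : xi (fun n => a n + b n) = xi a + xi b := by
  ext n
  simp only [xi, coeff_mk, map_add]
  split_ifs <;> simp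

theorem sum_antidiagonal_mul_eq_sum_range {R : Type*} [NonUnitalNonAssocSemiring R]
    (f : ℕ → R) {g : ℤ → R} (hg : ∀ n < 0, g n = 0) {n N : ℕ} (hN : n < N) :
    ∑ p ∈ Finset.HasAntidiagonal.antidiagonal n, f p.1 * g p.2 =
      ∑ k ∈ Finset.range N, f k * g (n - k) := by
  rw [Finset.Nat.sum_antidiagonal_eq_sum_range_succ fun i j => f i * g j]
  refine Finset.sum_subset_zero_on_sdiff (Finset.range_mono hN) (fun k hk => ?_) fun k hk => ?_
  · have hk : n < k := by
      simp only [Nat.succ_eq_add_one, Finset.mem_sdiff, Finset.mem_range] at hk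
      omega
    rw [hg _ (by omega), mul_zero]
  · rw [Nat.cast_sub (Finset.mem_range_succ_iff.1 hk)]

end Coefficients

section Exponential

open PowerSeries

variable {R : Type*} [CommRing R] [Algebra K R]

theorem expSeries_eq_subst [Algebra ℚ R] {f : R⟦X⟧} (hf : constantCoeff f = 0) :
    expSeries f = (exp R).subst f := by
  ext n
  have hcoeff : ∀ k : ℕ, n < k → coeff n (f ^ k) = 0 := fun k hk =>
    X_pow_dvd_iff.1 (pow_dvd_pow_of_dvd (X_dvd_iff.2 hf) k) n hk
  rw [coeff_subst' (HasSubst.of_constantCoeff_zero' hf), expSeries, coeff_mk]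
  symm
  rw [finsum_eq_sum_of_support_subset (s := Finset.range (n + 1))]
  · refine Finset.sum_congr rfl fun k _ => ?_
    rw [coeff_exp, algebraMap_smul, one_div, ← Rat.cast_smul_eq_qsmul K]
    push_cast
    rfl
  · intro k hk
    by_contra hnk
    exact hk (smul_eq_zero_of_right _ (hcoeff k (by simpa using hnk)))

theorem derivative_expSeries {f : R⟦X⟧} (hf : constantCoeff f = 0) :
    derivative R (expSeries f) = derivative R f * expSeries f := by
  let _ : Algebra ℚ R := Algebra.compHom R (algebraMap ℚ K)
  rw [expSeries_eq_subst hf, derivative_subst (HasSubst.of_constantCoeff_zero' hf),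
    derivative_exp, mul_comm]

/-- The quotient of a solution of `F' = f' F` by `exp f` has derivative zero. -/
theorem eq_expSeries {f F : R⟦X⟧} (hf : constantCoeff f = 0) (hF₀ : constantCoeff F = 1)
    (hF : derivative R F = derivative R f * F) : F = expSeries f := by
  let _ : Algebra ℚ R := Algebra.compHom R (algebraMap ℚ K)
  have : IsAddTorsionFree R := IsAddTorsionFree.of_module_rat R
  have hneg : constantCoeff (-f) = 0 := by rw [map_neg, hf, neg_zero]
  have mul_exp_neg : ∀ G : R⟦X⟧, constantCoeff G = 1 → derivative R G = derivative R f * G →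
      G * expSeries (-f) = 1 := fun G hG₀ hG => by
    refine derivative.ext ?_ (by rw [map_mul, hG₀, constantCoeff_expSeries, map_one, mul_one])
    rw [Derivation.leibniz, derivative_expSeries hneg, hG, map_neg, derivative_one]
    simp only [smul_eq_mul]
    ring
  calc F = F * (expSeries f * expSeries (-f)) := by
        rw [mul_exp_neg _ (constantCoeff_expSeries f) (derivative_expSeries hf), mul_one]
    _ = F * expSeries (-f) * expSeries f := by ring
    _ = expSeries f := by rw [mul_exp_neg F hF₀ hF, one_mul]

theorem expSeries_add {f g : R⟦X⟧} (hf : constantCoeff f = 0) (hg : constantCoeff g = 0) :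
    expSeries (f + g) = expSeries f * expSeries g := by
  symm
  apply eq_expSeries
  · rw [map_add, hf, hg, add_zero]
  · rw [map_mul, constantCoeff_expSeries, constantCoeff_expSeries, one_mul]
  · rw [Derivation.leibniz, derivative_expSeries hf, derivative_expSeries hg, map_add]
    simp only [smul_eq_mul]
    ring

theorem expSeries_rescale (u : R) (f : R⟦X⟧) :
    expSeries (rescale u f) = rescale u (expSeries f) := by
  ext n
  simp [expSeries, ← map_pow, coeff_rescale, Finset.mul_sum]

theorem xi_mul_pow (u : R) (a : ℕ+ → R) :
    xi (fun n => a n * u ^ (n : ℕ)) = rescale u (xi a) := by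
  ext n
  simp only [xi, coeff_mk, coeff_rescale]
  split_ifs
  · simp [mul_comm]
  · simp

theorem q_mul_pow (u : R) (a : ℕ+ → R) (n : ℕ) :
    q (fun k => a k * u ^ (k : ℕ)) n = q a n * u ^ n := by
  rw [q_natCast, q_natCast, xi_mul_pow, expSeries_rescale, coeff_rescale, mul_comm]

theorem q_add (a b : ℕ+ → R) (n : ℤ) {N : ℕ} (hN : n < N) :
    q (fun k => a k + b k) n = ∑ k ∈ Finset.range N, q a k * q b (n - k) := by
  rcases lt_or_ge n 0 with hn | hn
  · rw [q_of_neg _ hn, Finset.sum_eq_zero fun k _ => by rw [q_of_neg b (by omega), mul_zero]]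
  · lift n to ℕ using hn
    rw [← sum_antidiagonal_mul_eq_sum_range (fun k => q a k) (fun _ => q_of_neg b)
      (by exact_mod_cast hN)]
    simp only [q_natCast]
    rw [xi_add, expSeries_add (constantCoeff_xi a) (constantCoeff_xi b), coeff_mul]

/-- The coefficients of `E' = ξ' E` for `E = exp ξ`. -/
theorem smul_q (a : ℕ+ → R) (n : ℤ) {N : ℕ} (hN : n ≤ N) :
    (n : K) • q a n = ∑ i ∈ Finset.range N,
      (((i : K) + 1) * (1 - t ^ (i + 1))) • (a i.succPNat * q a (n - (i + 1))) := by
  rcases lt_trichotomy n 0 with hn | rfl | hn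
  · rw [q_of_neg a hn, smul_zero, Finset.sum_eq_zero fun i _ => by
      rw [q_of_neg a (by omega), mul_zero, smul_zero]]
  · rw [Int.cast_zero, zero_smul, Finset.sum_eq_zero fun i _ => by
      rw [q_of_neg a (by omega), mul_zero, smul_zero]]
  · obtain ⟨m, rfl⟩ : ∃ m : ℕ, n = (m + 1 : ℕ) := ⟨(n - 1).toNat, by omega⟩
    have coeff_derivative_exp := congrArg (coeff m) (derivative_expSeries (constantCoeff_xi a))
    rw [coeff_derivative, coeff_mul] at coeff_derivative_exp
    simp only [← q_natCast] at coeff_derivative_exp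
    rw [sum_antidiagonal_mul_eq_sum_range (fun i => coeff i (derivative R (xi a)))
      (fun _ => q_of_neg a) (by omega : m < N)] at coeff_derivative_exp
    calc (((m + 1 : ℕ) : ℤ) : K) • q a (m + 1 : ℕ) = q a (m + 1 : ℕ) * ((m : R) + 1) := by
          rw [Algebra.smul_def, mul_comm]
          simp
      _ = _ := coeff_derivative_exp
      _ = _ := Finset.sum_congr rfl fun i _ => by
          rw [coeff_derivative, coeff_xi_succ, Nat.cast_add, Nat.cast_one, add_sub_add_right_eq_sub,
            Algebra.smul_def, Algebra.smul_def]
          simp only [map_mul, map_add, map_natCast, map_one]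
          ring

end Exponential

section Commuting

universe u

variable {R : Type u} [Ring R] [Algebra K R]

/-- Identities between commuting elements of a noncommutative algebra can be checked in the
commutative subalgebra which they generate. -/
theorem exists_commRing_lift {ι : Type*} (a : ι → R) (ha : ∀ i j, Commute (a i) (a j)) :
    ∃ (C : Type u) (_ : CommRing C) (_ : Algebra K C) (φ : C →ₐ[K] R) (c : ι → C),
      ∀ i, φ (c i) = a i := by
  have := Algebra.isMulCommutative_adjoin K (s := Set.range a) <| by
    rintro _ ⟨i, rfl⟩ _ ⟨j, rfl⟩
    exact ha i j
  open scoped IsMulCommutative in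
  exact ⟨Algebra.adjoin K (Set.range a), inferInstance, inferInstance,
    (Algebra.adjoin K (Set.range a)).val, fun i => ⟨a i, Algebra.subset_adjoin ⟨i, rfl⟩⟩,
    fun _ => rfl⟩

theorem q_add_of_commute (a b : ℕ+ → R) (ha : ∀ i j, Commute (a i) (a j))
    (hb : ∀ i j, Commute (b i) (b j)) (hab : ∀ i j, Commute (a i) (b j)) (n : ℤ) {N : ℕ}
    (hN : n < N) :
    q (fun k => a k + b k) n = ∑ k ∈ Finset.range N, q a k * q b (n - k) := by
  obtain ⟨C, _, _, φ, c, hc⟩ := exists_commRing_lift (Sum.elim a b) <| by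
    rintro (i | i) (j | j)
    exacts [ha i j, hab i j, (hab j i).symm, hb i j]
  have lift_a : ∀ i, φ (c (Sum.inl i)) = a i := fun i => hc (Sum.inl i)
  have lift_b : ∀ i, φ (c (Sum.inr i)) = b i := fun i => hc (Sum.inr i)
  have lifted := congrArg φ (q_add (fun i => c (Sum.inl i)) (fun i => c (Sum.inr i)) n hN)
  simpa only [map_sum, map_mul, map_q, map_add, lift_a, lift_b] using lifted

theorem smul_q_of_commute (a : ℕ+ → R) (ha : ∀ i j, Commute (a i) (a j)) (n : ℤ) {N : ℕ}
    (hN : n ≤ N) :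
    (n : K) • q a n = ∑ i ∈ Finset.range N,
      (((i : K) + 1) * (1 - t ^ (i + 1))) • (a i.succPNat * q a (n - (i + 1))) := by
  obtain ⟨C, _, _, φ, c, hc⟩ := exists_commRing_lift a ha
  have lifted := congrArg φ (smul_q c n hN)
  simpa only [map_sum, map_mul, map_q, map_smul, hc] using lifted

theorem commute_q (a : ℕ+ → R) (ha : ∀ i j, Commute (a i) (a j)) (m n : ℤ) :
    Commute (q a m) (q a n) := by
  obtain ⟨C, _, _, φ, c, hc⟩ := exists_commRing_lift a ha
  have hφ : ∀ n, q a n = φ (q c n) := fun n => by simp only [map_q, hc]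
  rw [hφ, hφ]
  exact (Commute.all _ _).map φ

theorem eq_q_of_recurrence (a : ℕ+ → R) (ha : ∀ i j, Commute (a i) (a j)) (e : ℤ → R)
    (hneg : ∀ n < 0, e n = 0) (hzero : e 0 = 1)
    (he : ∀ (n : ℤ) (N : ℕ), n ≤ N → (n : K) • e n = ∑ i ∈ Finset.range N,
      (((i : K) + 1) * (1 - t ^ (i + 1))) • (a i.succPNat * e (n - (i + 1)))) :
    e = q a := by
  have hnat : ∀ m : ℕ, e m = q a m := fun m => by
    induction m using Nat.strong_induction_on with
    | _ m ih =>
      rcases Nat.eq_zero_or_pos m with rfl | hm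
      · rw [Nat.cast_zero, hzero, q_zero]
      · have hK : ((m : ℤ) : K) ≠ 0 := by exact_mod_cast hm.ne'
        refine smul_right_injective R hK ?_
        dsimp only
        rw [he m m le_rfl, smul_q_of_commute a ha m le_rfl]
        refine Finset.sum_congr rfl fun i hi => ?_
        have hi : i < m := Finset.mem_range.1 hi
        rw [show (m : ℤ) - (i + 1) = ((m - (i + 1) : ℕ) : ℤ) by omega, ih _ (by omega)]
  funext n
  rcases lt_or_ge n 0 with hn | hn
  · rw [hneg n hn, q_of_neg a hn]
  · lift n to ℕ using hn
    exact hnat n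

end Commuting

/-! ### Expansions of the raising and lowering factors -/

section GeometricSeries

open PowerSeries

theorem mk_pow_mul_one_sub_C_mul_X {R : Type*} [CommRing R] (c : R) :
    (mk fun n => c ^ n) * (1 - C c * X) = 1 := by
  have rescaled := congrArg (rescale c) (mk_one_mul_one_sub_eq_one R)
  simpa only [map_mul, rescale_mk, map_sub, map_one, rescale_X, Pi.one_apply, mul_one]
    using rescaled

variable {F : Type*} [Field F]

theorem inv_one_sub_C_mul_X (c : F) : (1 - C c * X)⁻¹ = mk fun n => c ^ n := by
  symm
  rw [PowerSeries.eq_inv_iff_mul_eq_one (by simp), mk_pow_mul_one_sub_C_mul_X]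

theorem inv_one_sub_C_mul_X_mul_cancel (c : F) : (1 - C c * X)⁻¹ * (1 - C c * X) = 1 :=
  PowerSeries.inv_mul_cancel _ (by simp)

theorem derivative_inv_one_sub_C_mul_X (c : F) :
    derivative F (1 - C c * X)⁻¹ = C c * (1 - C c * X)⁻¹ ^ 2 := by
  rw [derivative_inv', map_sub, derivative_one, Derivation.leibniz, derivative_X, derivative_C]
  simp only [smul_eq_mul]
  ring

/-- The weights `w` for which translating every `xₙ` by `wₙ uⁿ` produces the raising operators: the
`uᵏ`-coefficients of `exp ξ_t(w, u) = (1 - u) / (1 - t u)` are the `raiseCoeff k`. -/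
def raiseWeight (n : ℕ+) : K := -((n : ℕ) : K)⁻¹

/-- The weights `w` for which translating every `yₙ` by `wₙ uⁿ` produces the lowering operators: the
`uᵏ`-coefficients of `exp ξ_t(w, u)` are the `lowerCoeff k`. -/
def lowerWeight (n : ℕ+) : K := -((n : ℕ) : K)⁻¹ * (1 - t ^ (n : ℕ))

theorem expSeries_xi_raiseWeight :
    expSeries (xi raiseWeight) = (1 - X) * (1 - C t * X)⁻¹ := by
  symm
  apply eq_expSeries (constantCoeff_xi _) (by simp)
  have log_derivative : derivative K (xi raiseWeight) =
      C t * (1 - C t * X)⁻¹ - (1 - C 1 * X)⁻¹ := by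
    ext n
    rw [inv_one_sub_C_mul_X, inv_one_sub_C_mul_X]
    have hn : (n : K) + 1 ≠ 0 := by exact_mod_cast Nat.succ_ne_zero n
    simp only [coeff_derivative, coeff_xi_succ, raiseWeight, map_sub, coeff_C_mul, coeff_mk,
      Nat.succPNat_coe, Nat.succ_eq_add_one, Nat.cast_add_one, smul_eq_mul, one_pow]
    field_simp
    ring
  have cancel := inv_one_sub_C_mul_X_mul_cancel (1 : K)
  rw [log_derivative, Derivation.leibniz, derivative_inv_one_sub_C_mul_X]
  simp only [map_sub, derivative_one, derivative_X, smul_eq_mul, map_one, one_mul] at cancel ⊢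
  linear_combination (1 - C t * X : K⟦X⟧)⁻¹ * cancel

/-- `lowerWeight n + raiseWeight n * tⁿ = raiseWeight n`, so `exp ξ_t(lowerWeight, u)` is the
quotient of `(1 - u) / (1 - t u)` by its rescaling `(1 - t u) / (1 - t² u)`. -/
theorem expSeries_xi_lowerWeight :
    expSeries (xi lowerWeight) =
      (1 - X) * (1 - C t * X)⁻¹ * ((1 - C (t ^ 2) * X) * (1 - C t * X)⁻¹) := by
  have add_weights : (fun n => lowerWeight n + raiseWeight n * t ^ (n : ℕ)) = raiseWeight := by
    funext n
    rw [lowerWeight, raiseWeight]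
    ring
  have rescaled : expSeries (xi fun n => raiseWeight n * t ^ (n : ℕ)) * (1 - C (t ^ 2) * X) =
      1 - C t * X := by
    have rescaled_series :=
      congrArg (fun g => rescale t (g * (1 - C t * X))) expSeries_xi_raiseWeight
    simp only [mul_assoc, inv_one_sub_C_mul_X_mul_cancel] at rescaled_series
    rw [map_mul, ← expSeries_rescale, ← xi_mul_pow] at rescaled_series
    have hC : rescale t (C t) = (C t : K⟦X⟧) := by
      ext n
      rcases n with _ | n <;> simp [coeff_rescale, coeff_C]
    simpa [pow_two, mul_assoc, hC] using rescaled_series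
  have product := expSeries_add (constantCoeff_xi lowerWeight)
    (constantCoeff_xi fun n => raiseWeight n * t ^ (n : ℕ))
  rw [← xi_add, add_weights, expSeries_xi_raiseWeight] at product
  have cancel := inv_one_sub_C_mul_X_mul_cancel t
  linear_combination (-(1 - C (t ^ 2) * X) * (1 - C t * X)⁻¹ : K⟦X⟧) * product -
    expSeries (xi lowerWeight) * (1 - C t * X)⁻¹ * rescaled - expSeries (xi lowerWeight) * cancel

theorem raiseCoeff_eq_q (k : ℕ) : raiseCoeff k = q raiseWeight k := by
  rw [q_natCast, expSeries_xi_raiseWeight, raiseCoeff]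

theorem lowerCoeff_eq_q (k : ℕ) : lowerCoeff k = q lowerWeight k := by
  rw [q_natCast, expSeries_xi_lowerWeight, lowerCoeff]

theorem q_raiseWeight_sub (k : ℤ) :
    q raiseWeight k - t * q raiseWeight (k - 1) =
      (if k = 0 then 1 else 0) - (if k = 1 then 1 else 0) := by
  rcases lt_trichotomy k 0 with hk | rfl | hk
  · rw [q_of_neg _ hk, q_of_neg _ (by omega), if_neg (by omega), if_neg (by omega), mul_zero]
  · rw [q_zero, q_of_neg _ (by omega), if_pos rfl, if_neg (by omega), mul_zero]
  · obtain ⟨n, rfl⟩ : ∃ n : ℕ, k = (n + 1 : ℕ) := ⟨(k - 1).toNat, by omega⟩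
    have series : expSeries (xi raiseWeight) - C t * (expSeries (xi raiseWeight) * X) = 1 - X := by
      rw [expSeries_xi_raiseWeight]
      linear_combination (1 - X) * inv_one_sub_C_mul_X_mul_cancel t
    have coeff_eq := congrArg (coeff (n + 1)) series
    rw [map_sub, map_sub, coeff_C_mul, coeff_succ_mul_X, coeff_one, coeff_X, ← q_natCast,
      ← q_natCast] at coeff_eq
    rw [show ((n + 1 : ℕ) : ℤ) - 1 = n by omega, coeff_eq]
    norm_cast

end GeometricSeries

/-! ### Translations of polynomial rings -/

section Translation

open Polynomial

/-- The coefficient of `uʲ` in a polynomial in `u`, taken to be `0` for `j < 0`. -/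
def intCoeff {S : Type*} [Semiring S] (j : ℤ) : S[X] →ₗ[S] S :=
  if j < 0 then 0 else lcoeff S j.toNat

section IntCoeff

variable {S : Type*} [Semiring S]

theorem intCoeff_natCast (j : ℕ) (p : S[X]) : intCoeff j p = p.coeff j := by
  rw [intCoeff, if_neg (by omega), Int.toNat_natCast, lcoeff_apply]

theorem intCoeff_of_neg {j : ℤ} (hj : j < 0) (p : S[X]) : intCoeff j p = 0 := by
  rw [intCoeff, if_pos hj, LinearMap.zero_apply]

theorem intCoeff_C_mul (j : ℤ) (a : S) (p : S[X]) : intCoeff j (C a * p) = a * intCoeff j p := by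
  rw [← smul_eq_C_mul, map_smul, smul_eq_mul]

theorem intCoeff_mul_C (j : ℤ) (p : S[X]) (a : S) : intCoeff j (p * C a) = intCoeff j p * a := by
  unfold intCoeff
  split_ifs <;> simp

theorem intCoeff_mul_X_pow (j : ℤ) (p : S[X]) (i : ℕ) :
    intCoeff j (p * X ^ i) = intCoeff (j - i) p := by
  rcases lt_or_ge j 0 with hj | hj
  · rw [intCoeff_of_neg hj, intCoeff_of_neg (by omega)]
  · lift j to ℕ using hj
    rw [intCoeff_natCast, coeff_mul_X_pow']
    split_ifs with h
    · rw [← Nat.cast_sub h, intCoeff_natCast]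
    · rw [intCoeff_of_neg (by omega)]

theorem intCoeff_C (j : ℤ) (a : S) : intCoeff j (C a) = if j = 0 then a else 0 := by
  rcases lt_or_ge j 0 with hj | hj
  · rw [intCoeff_of_neg hj, if_neg (by omega)]
  · lift j to ℕ using hj
    rw [intCoeff_natCast, coeff_C]
    simp

end IntCoeff

variable {σ R : Type*} [CommRing R] (d : σ → ℕ) (w : σ → R)

/-- The translation `X_v ↦ X_v + w_v u^{d_v}` of the variables, where `u` is a new variable. -/
def translate : MvPolynomial σ R →ₐ[R] (MvPolynomial σ R)[X] :=
  MvPolynomial.aeval fun v => C (MvPolynomial.X v) + C (MvPolynomial.C (w v)) * X ^ d v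

theorem translate_X (v : σ) :
    translate d w (MvPolynomial.X v) =
      C (MvPolynomial.X v) + C (MvPolynomial.C (w v)) * X ^ d v :=
  MvPolynomial.aeval_X _ v

/-- The coefficient of `uʲ` in a translated polynomial, as an operator on polynomials. -/
def translateCoeff (j : ℤ) : Module.End R (MvPolynomial σ R) :=
  (intCoeff j).restrictScalars R ∘ₗ (translate d w).toLinearMap

theorem translateCoeff_apply (j : ℤ) (f : MvPolynomial σ R) :
    translateCoeff d w j f = intCoeff j (translate d w f) := rfl

theorem translateCoeff_of_neg {j : ℤ} (hj : j < 0) : translateCoeff d w j = 0 :=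
  LinearMap.ext fun _ => intCoeff_of_neg hj _

theorem translateCoeff_mul_X (j : ℤ) (f : MvPolynomial σ R) (v : σ) :
    translateCoeff d w j (f * MvPolynomial.X v) =
      translateCoeff d w j f * MvPolynomial.X v + w v • translateCoeff d w (j - d v) f := by
  simp only [translateCoeff_apply, map_mul]
  rw [translate_X, mul_add, map_add, intCoeff_mul_C, mul_left_comm, intCoeff_C_mul,
    intCoeff_mul_X_pow, MvPolynomial.smul_eq_C_mul]

theorem translateCoeff_C (j : ℤ) (a : R) :
    translateCoeff d w j (MvPolynomial.C a) = if j = 0 then MvPolynomial.C a else 0 := by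
  rw [translateCoeff_apply, ← intCoeff_C, ← MvPolynomial.algebraMap_eq, AlgHom.commutes]
  rfl

theorem translateCoeff_zero (hd : ∀ v, 0 < d v) : translateCoeff d w 0 = 1 := by
  refine LinearMap.ext fun f => ?_
  rw [Module.End.one_apply]
  induction f using MvPolynomial.induction_on with
  | C a => rw [translateCoeff_C, if_pos rfl]
  | add f g hf hg => rw [map_add, hf, hg]
  | mul_X f v hf =>
    have := hd v
    rw [translateCoeff_mul_X, hf, translateCoeff_of_neg d w (by omega), LinearMap.zero_apply,
      smul_zero, add_zero]

theorem translateCoeff_comm (w' : σ → R) (j k : ℤ) (f : MvPolynomial σ R) :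
    translateCoeff d w j (translateCoeff d w' k f) =
      translateCoeff d w' k (translateCoeff d w j f) := by
  induction f using MvPolynomial.induction_on generalizing j k with
  | C a =>
    rw [translateCoeff_C, translateCoeff_C]
    split_ifs <;> simp [translateCoeff_C, *]
  | add f g hf hg => simp only [map_add, hf, hg]
  | mul_X f v hf =>
    simp only [translateCoeff_mul_X, map_add, map_smul, hf]
    abel

theorem exists_translateCoeff_eq_zero (f : MvPolynomial σ R) :
    ∃ N : ℕ, ∀ k : ℤ, N ≤ k → translateCoeff d w k f = 0 := by
  refine ⟨(translate d w f).natDegree + 1, fun k hk => ?_⟩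
  lift k to ℕ using by omega
  rw [translateCoeff_apply, intCoeff_natCast]
  exact coeff_eq_zero_of_natDegree_lt (by omega)

theorem pderiv_translateCoeff_mul_X [DecidableEq σ] (j : ℤ) (f : MvPolynomial σ R) (u v : σ) :
    MvPolynomial.pderiv u (translateCoeff d w j (f * MvPolynomial.X v)) =
      MvPolynomial.pderiv u (translateCoeff d w j f) * MvPolynomial.X v +
        (if u = v then translateCoeff d w j f else 0) +
        w v • MvPolynomial.pderiv u (translateCoeff d w (j - d v) f) := by
  rw [translateCoeff_mul_X, map_add, Derivation.leibniz, Derivation.map_smul,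
    MvPolynomial.pderiv_X, Pi.single_apply]
  simp only [smul_eq_mul, mul_ite, mul_one, mul_zero, eq_comm (a := v)]
  ring

/-- Taylor's formula, in the form of the differential equation in `u` that it solves. -/
theorem smul_translateCoeff {s : Finset σ} {j : ℤ} (hs : ∀ v, w v ≠ 0 → d v ≤ j → v ∈ s)
    (f : MvPolynomial σ R) :
    (j : R) • translateCoeff d w j f =
      ∑ u ∈ s, ((d u : R) * w u) • MvPolynomial.pderiv u (translateCoeff d w (j - d u) f) := by
  classical
  induction f using MvPolynomial.induction_on generalizing j with
  | C a =>
    rw [Finset.sum_eq_zero fun u _ => by rw [translateCoeff_C]; split_ifs <;> simp,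
      translateCoeff_C]
    split_ifs with hj <;> simp [hj]
  | add f g hf hg => simp only [map_add, smul_add, hf hs, hg hs, Finset.sum_add_distrib]
  | mul_X f v hf =>
    have sum_delta : ∑ u ∈ s, ((d u : R) * w u) •
        (if u = v then translateCoeff d w (j - d u) f else 0) =
          ((d v : R) * w v) • translateCoeff d w (j - d v) f := by
      simp only [smul_ite, smul_zero, Finset.sum_ite_eq']
      split_ifs with hv
      · rfl
      · rcases eq_or_ne (w v) 0 with hw | hw
        · rw [hw, mul_zero, zero_smul]
        · rw [translateCoeff_of_neg d w (by have := mt (hs v hw) hv; omega), LinearMap.zero_apply,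
            smul_zero]
    have ih := hf fun u hu hj => hs u hu (by omega : (d u : ℤ) ≤ j)
    have ih' := hf (j := j - d v) fun u hu hj => hs u hu (by omega)
    simp only [pderiv_translateCoeff_mul_X, smul_add, Finset.sum_add_distrib, sum_delta,
      ← smul_mul_assoc, ← Finset.sum_mul, smul_comm _ (w v), ← Finset.smul_sum,
      sub_right_comm j _ (d v : ℤ)]
    rw [← ih, ← ih', translateCoeff_mul_X]
    simp only [MvPolynomial.smul_eq_C_mul, map_mul, map_sub, map_natCast, map_intCast, Int.cast_sub,
      Int.cast_natCast]
    ring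

end Translation

section TranslateQ

open Polynomial

variable {B : Type*} [CommRing B] [Algebra K B] {φ : B →ₐ[K] B[X]} {a : ℕ+ → B} {c : ℕ+ → K}

theorem map_q_of_translate (h : ∀ n, φ (a n) = C (a n) + C (algebraMap K B (c n)) * X ^ (n : ℕ))
    (m : ℤ) {N : ℕ} (hN : m < N) :
    φ (q a m) = ∑ k ∈ Finset.range N, C (q c k • q a (m - k)) * X ^ k := by
  have hφ : (fun n => φ (a n)) =
      fun n => Algebra.ofId K B[X] (c n) * X ^ (n : ℕ) + CAlgHom (R := K) (a n) := by
    funext n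
    rw [h, add_comm]
    rfl
  rw [map_q, hφ, q_add _ _ m hN]
  refine Finset.sum_congr rfl fun k _ => ?_
  rw [q_mul_pow, ← map_q, ← map_q, Algebra.smul_def, C_mul]
  change C (algebraMap K B (q c k)) * X ^ k * C (q a (m - k)) = _
  ring

theorem intCoeff_map_q_of_translate
    (h : ∀ n, φ (a n) = C (a n) + C (algebraMap K B (c n)) * X ^ (n : ℕ)) (j m : ℤ) :
    intCoeff j (φ (q a m)) = q c j • q a (m - j) := by
  rcases lt_or_ge j 0 with hj | hj
  · rw [intCoeff_of_neg hj, q_of_neg c hj, zero_smul]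
  · lift j to ℕ using hj
    rw [map_q_of_translate h m (N := m.toNat + j + 1) (by omega), map_sum,
      Finset.sum_eq_single_of_mem j (Finset.mem_range.2 (by omega))]
    · rw [intCoeff_mul_X_pow, sub_self, intCoeff_C, if_pos rfl]
    · intro k _ hk
      rw [intCoeff_mul_X_pow, intCoeff_C, if_neg (by omega)]

theorem map_q_of_fixed (h : ∀ n, φ (a n) = C (a n)) (m : ℤ) : φ (q a m) = C (q a m) := by
  rw [map_q, funext h]
  exact (map_q (CAlgHom (R := K)) a m).symm

end TranslateQ

/-! ### Vertex operators -/

section Shifts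

open Polynomial

/-- The index of a variable: `n` for both `xₙ` and `yₙ`. -/
def varIndex : ℕ+ ⊕ ℕ+ → ℕ := Sum.elim (fun n => n) fun n => n

theorem varIndex_pos (v : ℕ+ ⊕ ℕ+) : 0 < varIndex v := by
  rcases v with n | n <;> exact n.pos

/-- The translation of the variables `xₙ` that produces the raising operators. -/
abbrev xTranslate : A →ₐ[K] A[X] := translate varIndex (Sum.elim raiseWeight 0)

/-- The translation of the variables `yₙ` that produces the lowering operators. -/
abbrev yTranslate : A →ₐ[K] A[X] := translate varIndex (Sum.elim 0 lowerWeight)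

/-- The coefficients of `xTranslate`. -/
abbrev xShift (k : ℤ) : Module.End K A := translateCoeff varIndex (Sum.elim raiseWeight 0) k

/-- The coefficients of `yTranslate`. -/
abbrev yShift (k : ℤ) : Module.End K A := translateCoeff varIndex (Sum.elim 0 lowerWeight) k

theorem xTranslate_x (n : ℕ+) :
    xTranslate (x n) = C (x n) + C (algebraMap K A (raiseWeight n)) * X ^ (n : ℕ) :=
  translate_X _ _ _

theorem xTranslate_y (n : ℕ+) : xTranslate (y n) = C (y n) := by
  rw [y, translate_X, Sum.elim_inr, Pi.zero_apply, map_zero, map_zero, zero_mul, add_zero]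

theorem yTranslate_x (n : ℕ+) : yTranslate (x n) = C (x n) := by
  rw [x, translate_X, Sum.elim_inl, Pi.zero_apply, map_zero, map_zero, zero_mul, add_zero]

theorem yTranslate_y (n : ℕ+) :
    yTranslate (y n) = C (y n) + C (algebraMap K A (lowerWeight n)) * X ^ (n : ℕ) :=
  translate_X _ _ _

theorem xTranslate_q_sub (m : ℤ) :
    xTranslate (q x m) - C (MvPolynomial.C t) * xTranslate (q x (m - 1)) * X =
      C (q x m) - C (q x (m - 1)) * X := by
  ext1 n
  have coeff_q (i l : ℤ) : intCoeff i (xTranslate (q x l)) = q raiseWeight i • q x (l - i) :=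
    intCoeff_map_q_of_translate xTranslate_x i l
  have coeff_X (p : A[X]) : intCoeff n (p * X) = intCoeff (n - 1 : ℤ) p := by
    simpa using intCoeff_mul_X_pow n p 1
  rw [← intCoeff_natCast, ← intCoeff_natCast, map_sub, map_sub, coeff_X, coeff_X, intCoeff_C_mul,
    coeff_q, coeff_q, intCoeff_C, intCoeff_C, ← MvPolynomial.smul_eq_C_mul, smul_smul,
    sub_sub_sub_cancel_right, ← sub_smul, q_raiseWeight_sub]
  split_ifs with h₀ h₁ <;> first | omega | simp [*]

theorem xShift_q_mul_sub (k m : ℤ) (g : A) :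
    xShift k (q x m * g) - t • xShift (k - 1) (q x (m - 1) * g) =
      q x m * xShift k g - q x (m - 1) * xShift (k - 1) g := by
  have coeff_X_mul (p : A[X]) : intCoeff k (X * p) = intCoeff (k - 1) p := by
    simpa [X_mul] using intCoeff_mul_X_pow k p 1
  have coeff_eq := congrArg (fun p => intCoeff k (p * xTranslate g)) (xTranslate_q_sub m)
  simp only [sub_mul, map_sub, mul_assoc, intCoeff_C_mul] at coeff_eq
  rw [mul_left_comm, coeff_X_mul, coeff_X_mul, ← MvPolynomial.smul_eq_C_mul, ← map_mul,
    ← map_mul] at coeff_eq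
  exact coeff_eq

theorem yShift_q_mul (k m : ℤ) (g : A) : yShift k (q x m * g) = q x m * yShift k g := by
  rw [translateCoeff_apply, map_mul, map_q_of_fixed yTranslate_x, intCoeff_C_mul,
    translateCoeff_apply]

end Shifts

section Annihilation

/-- The annihilation part `-(1/n) ∂/∂yₙ` of `xOp n`. -/
def yDeriv (n : ℕ+) : Module.End K A :=
  -(((n : ℕ) : K)⁻¹ • (MvPolynomial.pderiv (Sum.inr n)).toLinearMap)

theorem yDeriv_apply (n : ℕ+) (f : A) :
    yDeriv n f = -(((n : ℕ) : K)⁻¹ • MvPolynomial.pderiv (Sum.inr n) f) := rfl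

theorem pderiv_comm {σ R : Type*} [CommRing R] (i j : σ) (f : MvPolynomial σ R) :
    MvPolynomial.pderiv i (MvPolynomial.pderiv j f) =
      MvPolynomial.pderiv j (MvPolynomial.pderiv i f) := by
  classical
  have bracket : ⁅(MvPolynomial.pderiv i : Derivation R (MvPolynomial σ R) (MvPolynomial σ R)),
      (MvPolynomial.pderiv j : Derivation R (MvPolynomial σ R) (MvPolynomial σ R))⁆ = 0 := by
    refine MvPolynomial.derivation_ext fun v => ?_
    rw [Derivation.commutator_apply, MvPolynomial.pderiv_X, MvPolynomial.pderiv_X,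
      Pi.single_apply, Pi.single_apply]
    split_ifs <;> simp
  rw [← sub_eq_zero, ← Derivation.commutator_apply, bracket, Derivation.zero_apply]

theorem commute_yDeriv (i j : ℕ+) : Commute (yDeriv i) (yDeriv j) := by
  refine LinearMap.ext fun f => ?_
  simp only [Module.End.mul_apply, yDeriv_apply, map_neg, Derivation.map_smul, neg_neg]
  rw [smul_comm, pderiv_comm]

theorem commute_mulLeft (i j : ℕ+) :
    Commute (LinearMap.mulLeft K (x i) : Module.End K A) (LinearMap.mulLeft K (x j)) :=
  (Commute.all (x i) (x j)).map (Algebra.lmul K A)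

theorem commute_yDeriv_mulLeft (i j : ℕ+) :
    Commute (yDeriv i) (LinearMap.mulLeft K (x j) : Module.End K A) := by
  refine LinearMap.ext fun f => ?_
  simp only [Module.End.mul_apply, yDeriv_apply, LinearMap.mulLeft_apply, Derivation.leibniz]
  simp [x, MvPolynomial.pderiv_X]

theorem xOp_eq : xOp = fun n => yDeriv n + LinearMap.mulLeft K (x n) := by
  funext n
  rw [xOp, yDeriv, neg_add_eq_sub]

theorem commute_xOp (i j : ℕ+) : Commute (xOp i) (xOp j) := by
  rw [xOp_eq]
  exact ((commute_yDeriv i j).add_right (commute_yDeriv_mulLeft i j)).add_left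
    ((commute_yDeriv_mulLeft j i).symm.add_right (commute_mulLeft i j))

theorem q_yDeriv : q yDeriv = yShift := by
  symm
  refine eq_q_of_recurrence yDeriv commute_yDeriv yShift (fun n => translateCoeff_of_neg _ _)
    (translateCoeff_zero _ _ varIndex_pos) fun n N hN => LinearMap.ext fun f => ?_
  have smul_yShift := smul_translateCoeff varIndex (Sum.elim 0 lowerWeight) (j := n)
    (s := (Finset.range N).map ⟨fun i => Sum.inr i.succPNat, fun _ _ h => by simpa using h⟩)
    (by
      rintro (v | v) hv hvn
      · exact absurd rfl hv
      · have : (v : ℤ) ≤ n := hvn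
        have := v.pos
        exact Finset.mem_map.2 ⟨v.natPred, Finset.mem_range.2 (by
          rw [PNat.natPred]
          omega), congrArg Sum.inr v.succPNat_natPred⟩) f
  rw [LinearMap.smul_apply, smul_yShift, Finset.sum_map, LinearMap.sum_apply]
  refine Finset.sum_congr rfl fun i _ => ?_
  rw [LinearMap.smul_apply, Module.End.mul_apply, yDeriv_apply, smul_neg, smul_smul, ← neg_smul]
  change (((i + 1 : ℕ) : K) * (-((i + 1 : ℕ) : K)⁻¹ * (1 - t ^ (i + 1)))) •
    MvPolynomial.pderiv (Sum.inr i.succPNat) (yShift (n - (i + 1 : ℕ)) f) = _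
  rw [Nat.succPNat_coe, Nat.succ_eq_add_one]
  push_cast
  congr 1
  ring

theorem q_mulLeft (n : ℤ) :
    q (fun k => (LinearMap.mulLeft K (x k) : Module.End K A)) n = LinearMap.mulLeft K (q x n) :=
  (map_q (Algebra.lmul K A) x n).symm

theorem q_xOp_apply (n : ℤ) (f : A) {N : ℕ} (hN : n < N) :
    q xOp n f = ∑ j ∈ Finset.range N, q x (n - j) * yShift j f := by
  rw [xOp_eq, q_add_of_commute yDeriv _ commute_yDeriv commute_mulLeft commute_yDeriv_mulLeft n hN,
    LinearMap.sum_apply]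
  refine Finset.sum_congr rfl fun j _ => ?_
  rw [Module.End.mul_apply, q_yDeriv, q_mulLeft, LinearMap.mulLeft_apply, yShift_q_mul]

theorem q_xOp_comm (m n : ℤ) (f : A) : q xOp m (q xOp n f) = q xOp n (q xOp m f) :=
  LinearMap.congr_fun (commute_q xOp commute_xOp m n) f

theorem xShift_q_xOp_sub (k m : ℤ) (f : A) :
    xShift k (q xOp m f) - t • xShift (k - 1) (q xOp (m - 1) f) =
      q xOp m (xShift k f) - q xOp (m - 1) (xShift (k - 1) f) := by
  have h (g : A) : q xOp m g = ∑ j ∈ Finset.range (m.toNat + 1), q x (m - j) * yShift j g :=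
    q_xOp_apply m g (by omega)
  have h' (g : A) : q xOp (m - 1) g =
      ∑ j ∈ Finset.range (m.toNat + 1), q x (m - j - 1) * yShift j g := by
    simpa only [sub_right_comm] using q_xOp_apply (m - 1) g (N := m.toNat + 1) (by omega)
  simp only [h, h', map_sum, Finset.smul_sum]
  rw [← Finset.sum_sub_distrib, ← Finset.sum_sub_distrib]
  refine Finset.sum_congr rfl fun j _ => ?_
  rw [xShift_q_mul_sub, translateCoeff_comm _ _ _ k j, translateCoeff_comm _ _ _ (k - 1) j]

end Annihilation

section VertexOperators

/-- The vertex operator `Bₙ = ∑ₖ qₙ₊ₖ(x - ∂̃_y) ∘ xShift k`, which prepends the part `n` to the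
first index sequence. -/
def vertexOp (n : ℤ) : A →ₗ[K] A :=
  (Polynomial.lsum fun k => q xOp (n + k)) ∘ₗ xTranslate.toLinearMap

theorem vertexOp_apply (n : ℤ) (f : A) {N : ℕ} (hN : ∀ k : ℤ, N ≤ k → xShift k f = 0) :
    vertexOp n f = ∑ k ∈ Finset.range N, q xOp (n + k) (xShift k f) := by
  have coeff_eq (k : ℕ) : (xTranslate f).coeff k = xShift k f := (intCoeff_natCast k _).symm
  rw [vertexOp, LinearMap.comp_apply, Polynomial.lsum_apply]
  simp only [← coeff_eq]
  refine Polynomial.sum_eq_of_subset _ (fun k => map_zero _) fun k hk => Finset.mem_range.2 ?_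
  by_contra! hNk
  exact Polynomial.mem_support_iff.1 hk ((coeff_eq k).trans (hN k (by exact_mod_cast hNk)))

theorem vertexOp_add_one_apply (n : ℤ) (f : A) {N : ℕ}
    (hN : ∀ k : ℤ, N ≤ k → xShift k f = 0) :
    vertexOp (n + 1) f = ∑ k ∈ Finset.range (N + 1), q xOp (n + k) (xShift (k - 1) f) := by
  rw [vertexOp_apply (n + 1) f hN, Finset.sum_range_succ', Nat.cast_zero,
    show xShift (0 - 1) = 0 from translateCoeff_of_neg _ _ (by norm_num), LinearMap.zero_apply,
    map_zero, add_zero]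
  refine Finset.sum_congr rfl fun k _ => ?_
  push_cast
  rw [add_sub_cancel_right, add_right_comm, add_assoc n]

theorem vertexOp_q_xOp_sub (n m : ℤ) (f : A) :
    vertexOp n (q xOp m f) - t • vertexOp (n + 1) (q xOp (m - 1) f) =
      q xOp m (vertexOp n f) - q xOp (m - 1) (vertexOp (n + 1) f) := by
  obtain ⟨N₁, h₁⟩ := exists_translateCoeff_eq_zero varIndex (Sum.elim raiseWeight 0) f
  obtain ⟨N₂, h₂⟩ := exists_translateCoeff_eq_zero varIndex (Sum.elim raiseWeight 0) (q xOp m f)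
  obtain ⟨N₃, h₃⟩ :=
    exists_translateCoeff_eq_zero varIndex (Sum.elim raiseWeight 0) (q xOp (m - 1) f)
  let N := N₁ + N₂ + N₃
  rw [vertexOp_apply n (q xOp m f) (N := N + 1) (fun k hk => h₂ k (by omega)),
    vertexOp_add_one_apply n (q xOp (m - 1) f) (N := N) (fun k hk => h₃ k (by omega)),
    vertexOp_apply n f (N := N + 1) (fun k hk => h₁ k (by omega)),
    vertexOp_add_one_apply n f (N := N) (fun k hk => h₁ k (by omega))]
  simp only [map_sum, Finset.smul_sum]
  rw [← Finset.sum_sub_distrib, ← Finset.sum_sub_distrib]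
  refine Finset.sum_congr rfl fun k _ => ?_
  rw [← map_smul, ← map_sub, xShift_q_xOp_sub, map_sub, q_xOp_comm, q_xOp_comm (n + k)]

theorem exists_vertexOp_vertexOp_sub (f : A) : ∃ S : ℤ → ℤ → A, (∀ n r, S n r = S r n) ∧
    ∀ n r, vertexOp n (vertexOp r f) - t • vertexOp (n + 1) (vertexOp (r - 1) f) =
      S n r - S (n + 1) (r - 1) := by
  obtain ⟨N, hN⟩ := exists_translateCoeff_eq_zero varIndex (Sum.elim raiseWeight 0) f
  refine ⟨fun n r => ∑ k ∈ Finset.range N, ∑ j ∈ Finset.range N,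
    q xOp (r + k) (q xOp (n + j) (xShift j (xShift k f))), fun n r => ?_, fun n r => ?_⟩
  · refine Finset.sum_comm.trans
      (Finset.sum_congr rfl fun k _ => Finset.sum_congr rfl fun j _ => ?_)
    rw [q_xOp_comm, translateCoeff_comm]
  · have vertexOp_xShift (n : ℤ) (k : ℕ) : ∑ j ∈ Finset.range N,
        q xOp (n + j) (xShift j (xShift k f)) = vertexOp n (xShift k f) :=
      (vertexOp_apply n _ fun j hj => by rw [translateCoeff_comm, hN j hj, map_zero]).symm
    rw [vertexOp_apply r f hN, vertexOp_apply (r - 1) f hN]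
    simp only [← map_sum, vertexOp_xShift]
    simp only [map_sum, Finset.smul_sum]
    rw [← Finset.sum_sub_distrib, ← Finset.sum_sub_distrib]
    refine Finset.sum_congr rfl fun k _ => ?_
    rw [sub_add_eq_add_sub, vertexOp_q_xOp_sub]

/-- By `exists_vertexOp_vertexOp_sub`, the left side changes its sign under the involution
`(n, r) ↦ (r - 1, n + 1)`. -/
theorem vertexOp_vertexOp (n r : ℤ) (f : A) :
    vertexOp n (vertexOp r f) - t • vertexOp (n + 1) (vertexOp (r - 1) f) =
      t • vertexOp r (vertexOp n f) - vertexOp (r - 1) (vertexOp (n + 1) f) := by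
  obtain ⟨S, S_symm, hS⟩ := exists_vertexOp_vertexOp_sub f
  have swapped := hS (r - 1) (n + 1)
  rw [sub_add_cancel, add_sub_cancel_right] at swapped
  rw [hS n r, S_symm n r, S_symm (n + 1) (r - 1), ← neg_sub (S (r - 1) (n + 1)), ← swapped,
    neg_sub]

end VertexOperators

/-! ### Raising operators -/

section Products

open Polynomial

theorem map_prod_q_mul_of_translate {B : Type*} [CommRing B] [Algebra K B] {φ : B →ₐ[K] B[X]}
    {a : ℕ+ → B} {c : ℕ+ → K}
    (h : ∀ n, φ (a n) = C (a n) + C (algebraMap K B (c n)) * X ^ (n : ℕ)) {ι : Type*} [Fintype ι]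
    [DecidableEq ι] (α : ι → ℤ) {N : ℕ} (hN : ∀ i, α i < N) {g : B} (hg : φ g = C g) :
    φ ((∏ i, q a (α i)) * g) = ∑ k ∈ Fintype.piFinset fun _ : ι => Finset.range N,
      C ((∏ i, q c (k i)) • ((∏ i, q a (α i - k i)) * g)) * X ^ ∑ i, k i := by
  rw [map_mul, map_prod, hg, Finset.prod_congr rfl fun i _ => map_q_of_translate h (α i) (hN i),
    Finset.prod_univ_sum, Finset.sum_mul]
  refine Finset.sum_congr rfl fun k _ => ?_
  rw [Finset.prod_mul_distrib, Finset.prod_pow_eq_pow_sum, ← map_prod, mul_right_comm, ← C_mul,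
    Finset.prod_smul, smul_mul_assoc]

theorem lsum_C_mul_X_pow {R B M : Type*} [CommSemiring R] [Semiring B] [Algebra R B]
    [AddCommMonoid M] [Module R M] (F : ℕ → B →ₗ[R] M) (a : B) (k : ℕ) :
    lsum F (C a * X ^ k) = F k a := by
  rw [C_mul_X_pow_eq_monomial, lsum_apply, sum_monomial_index _ _ (map_zero (F k))]

theorem q_xOp_eq_lsum (m : ℤ) (f : A) :
    q xOp m f = lsum (fun j => LinearMap.mulLeft K (q x (m - j))) (yTranslate f) := by
  have coeff_eq (k : ℕ) : yShift k f = (yTranslate f).coeff k := intCoeff_natCast k _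
  let N := m.toNat + (yTranslate f).natDegree + 1
  rw [q_xOp_apply m f (N := N) (by omega), lsum_apply, sum_over_range' _ _ N (by omega)]
  · simp only [coeff_eq, LinearMap.mulLeft_apply]
  · exact fun k => map_zero _

theorem q_xOp_qPair (m : ℤ) {l l' : ℕ} (α : Fin l → ℤ) (β : Fin l' → ℤ) {N : ℕ}
    (hN : ∀ a, β a < N) :
    q xOp m (qPair α β) = ∑ d ∈ Fintype.piFinset fun _ : Fin l' => Finset.range N,
      (∏ a, lowerCoeff (d a)) • (q x (m - ∑ a, (d a : ℤ)) * qPair α fun a => β a - d a) := by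
  have fixed : yTranslate (∏ i, q x (α i)) = C (∏ i, q x (α i)) := by
    rw [map_prod, map_prod]
    exact Finset.prod_congr rfl fun i _ => map_q_of_fixed yTranslate_x _
  rw [q_xOp_eq_lsum, qPair, mul_comm, map_prod_q_mul_of_translate yTranslate_y β hN fixed, map_sum]
  refine Finset.sum_congr rfl fun d _ => ?_
  rw [lsum_C_mul_X_pow, map_smul, LinearMap.mulLeft_apply, Nat.cast_sum,
    mul_comm (∏ a, q y (β a - d a)), qPair]
  simp only [lowerCoeff_eq_q]

theorem vertexOp_qPair (n : ℤ) {l l' : ℕ} (α : Fin l → ℤ) (β : Fin l' → ℤ) {N : ℕ}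
    (hα : ∀ i, α i < N) (hβ : ∀ a, β a < N) :
    vertexOp n (qPair α β) = ∑ k ∈ Fintype.piFinset fun _ : Fin l => Finset.range N,
      ∑ d ∈ Fintype.piFinset fun _ : Fin l' => Finset.range N,
        ((∏ i, raiseCoeff (k i)) * ∏ a, lowerCoeff (d a)) •
          (q x (n + ∑ i, (k i : ℤ) - ∑ a, (d a : ℤ)) *
            qPair (fun i => α i - k i) fun a => β a - d a) := by
  have fixed : xTranslate (∏ a, q y (β a)) = C (∏ a, q y (β a)) := by
    rw [map_prod, map_prod]
    exact Finset.prod_congr rfl fun a _ => map_q_of_fixed xTranslate_y _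
  rw [vertexOp, LinearMap.comp_apply, AlgHom.toLinearMap_apply, qPair,
    map_prod_q_mul_of_translate xTranslate_x α hα fixed, map_sum]
  refine Finset.sum_congr rfl fun k _ => ?_
  rw [lsum_C_mul_X_pow, map_smul, ← qPair, q_xOp_qPair _ _ _ hβ, Finset.smul_sum]
  refine Finset.sum_congr rfl fun d _ => ?_
  rw [smul_smul, Nat.cast_sum]
  simp only [raiseCoeff_eq_q]

theorem qPair_eq_zero_of_neg_left {l l' : ℕ} {α : Fin l → ℤ} {i : Fin l} (hi : α i < 0)
    (β : Fin l' → ℤ) : qPair α β = 0 := by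
  rw [qPair, Finset.prod_eq_zero (Finset.mem_univ i) (q_of_neg x hi), zero_mul]

theorem qPair_eq_zero_of_neg_right {l l' : ℕ} (α : Fin l → ℤ) {β : Fin l' → ℤ} {a : Fin l'}
    (ha : β a < 0) : qPair α β = 0 := by
  rw [qPair, Finset.prod_eq_zero (Finset.mem_univ a) (q_of_neg y ha), mul_zero]

theorem exists_natCast_gt {ι : Type*} [Finite ι] (α : ι → ℤ) : ∃ N : ℕ, ∀ i, α i < N := by
  obtain ⟨M, hM⟩ := (Set.finite_range α).bddAbove
  exact ⟨M.toNat + 1, fun i => by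
    have := hM ⟨i, rfl⟩
    omega⟩

theorem vertexOp_qPair_finsum (n : ℤ) {l l' : ℕ} (α : Fin l → ℤ) (β : Fin l' → ℤ) :
    vertexOp n (qPair α β) = ∑ᶠ s : (Fin l → ℕ) × (Fin l' → ℕ),
        ((∏ i, raiseCoeff (s.1 i)) * ∏ a, lowerCoeff (s.2 a)) •
          (q x (n + ∑ i, (s.1 i : ℤ) - ∑ a, (s.2 a : ℤ)) *
            qPair (fun i => α i - s.1 i) fun a => β a - s.2 a) := by
  obtain ⟨N, hN⟩ := exists_natCast_gt (Sum.elim α β)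
  have hα (i : Fin l) : α i < N := hN (Sum.inl i)
  have hβ (a : Fin l') : β a < N := hN (Sum.inr a)
  rw [vertexOp_qPair n α β hα hβ, ← Finset.sum_product']
  symm
  refine finsum_eq_sum_of_support_subset _ fun s hs => ?_
  have qPair_ne_zero : qPair (fun i => α i - s.1 i) (fun a => β a - s.2 a) ≠ 0 := fun h =>
    hs (by simp only [h, mul_zero, smul_zero])
  simp only [Finset.coe_product, Set.mem_prod, Finset.mem_coe, Fintype.mem_piFinset,
    Finset.mem_range]
  constructor
  · intro i
    by_contra! hi
    exact qPair_ne_zero (qPair_eq_zero_of_neg_left (i := i) (by have := hα i; omega) _)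
  · intro a
    by_contra! ha
    exact qPair_ne_zero (qPair_eq_zero_of_neg_right _ (a := a) (by have := hβ a; omega))

end Products

section Prepend

/-- A pair `i < j` of indices in `Fin (l + 1)` is either `(0, j + 1)` or `(i + 1, j + 1)` for a pair
`i < j` in `Fin l`. -/
def pairsEquiv (l : ℕ) : Fin l ⊕ Pairs l ≃ Pairs (l + 1) :=
  Equiv.ofBijective
    (Sum.elim (fun j => ⟨(0, j.succ), Fin.succ_pos j⟩)
      fun p => ⟨(p.1.1.succ, p.1.2.succ), Fin.succ_lt_succ_iff.2 p.2⟩) <| by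
    constructor
    · rintro (i | ⟨⟨i, j⟩, h⟩) (i' | ⟨⟨i', j'⟩, h'⟩) <;>
        simp [Fin.succ_ne_zero, (Fin.succ_ne_zero _).symm]
    · rintro ⟨⟨i, j⟩, h⟩
      induction j using Fin.cases with
      | zero => exact absurd h (Fin.not_lt_zero _)
      | succ j =>
        induction i using Fin.cases with
        | zero => exact ⟨Sum.inl j, rfl⟩
        | succ i => exact ⟨Sum.inr ⟨(i, j), Fin.succ_lt_succ_iff.1 h⟩, rfl⟩

theorem pairsEquiv_inl {l : ℕ} (j : Fin l) :
    (pairsEquiv l (Sum.inl j)).1 = (0, j.succ) := rfl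

theorem pairsEquiv_inr {l : ℕ} (p : Pairs l) :
    (pairsEquiv l (Sum.inr p)).1 = (p.1.1.succ, p.1.2.succ) := rfl

/-- The splitting of a rectangle with `l + 1` rows into its first row and the other rows. -/
def boxEquiv (l l' : ℕ) : Fin l' ⊕ Fin l × Fin l' ≃ Fin (l + 1) × Fin l' :=
  Equiv.ofBijective (Sum.elim (fun a => (0, a)) fun p => (p.1.succ, p.2)) <| by
    constructor
    · rintro (i | ⟨i, j⟩) (i' | ⟨i', j'⟩) <;>
        simp [Fin.succ_ne_zero, (Fin.succ_ne_zero _).symm]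
    · rintro ⟨i, j⟩
      induction i using Fin.cases with
      | zero => exact ⟨Sum.inl j, rfl⟩
      | succ i => exact ⟨Sum.inr (i, j), rfl⟩

theorem boxEquiv_inl {l l' : ℕ} (a : Fin l') : boxEquiv l l' (Sum.inl a) = (0, a) := rfl

theorem boxEquiv_inr {l l' : ℕ} (p : Fin l × Fin l') :
    boxEquiv l l' (Sum.inr p) = (p.1.succ, p.2) := rfl

/-- The exponents in a term of the raising operator formula for index sequences of lengths `l + 1`
and `l'`, with the exponents of the operators that involve the first index put last. -/
def exponentsEquiv (l l' : ℕ) :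
    ((Pairs l → ℕ) × (Pairs l' → ℕ) × (Fin l × Fin l' → ℕ)) × ((Fin l → ℕ) × (Fin l' → ℕ)) ≃
      (Pairs (l + 1) → ℕ) × (Pairs l' → ℕ) × (Fin (l + 1) × Fin l' → ℕ) where
  toFun s := (Sum.elim s.2.1 s.1.1 ∘ (pairsEquiv l).symm, s.1.2.1,
    Sum.elim s.2.2 s.1.2.2 ∘ (boxEquiv l l').symm)
  invFun e := ((e.1 ∘ pairsEquiv l ∘ Sum.inr, e.2.1, e.2.2 ∘ boxEquiv l l' ∘ Sum.inr),
    (e.1 ∘ pairsEquiv l ∘ Sum.inl, e.2.2 ∘ boxEquiv l l' ∘ Sum.inl))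
  left_inv s := by
    ext <;> simp
  right_inv e := by
    refine Prod.ext ?_ (Prod.ext rfl ?_)
    · funext p
      obtain ⟨s | s, rfl⟩ := (pairsEquiv l).surjective p <;> simp
    · funext p
      obtain ⟨s | s, rfl⟩ := (boxEquiv l l').surjective p <;> simp

theorem raise_cons {l : ℕ} (k : Fin l → ℕ) (k₀ : Pairs l → ℕ) (n : ℤ) (α : Fin l → ℤ) :
    raise (Sum.elim k k₀ ∘ (pairsEquiv l).symm) (Fin.cons n α : Fin (l + 1) → ℤ) =
      Fin.cons (n + ∑ i, (k i : ℤ)) fun i => raise k₀ α i - k i := by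
  rw [raise, ← Equiv.sum_comp (pairsEquiv l), Fintype.sum_sum_type]
  funext i
  induction i using Fin.cases with
  | zero => simp [pairsEquiv_inl, pairsEquiv_inr, Finset.sum_apply, (Fin.succ_ne_zero _).symm]
  | succ i =>
    simp only [Function.comp_apply, Equiv.symm_apply_apply, Sum.elim_inl, pairsEquiv_inl,
      zsmul_eq_mul, Int.cast_natCast, Sum.elim_inr, pairsEquiv_inr, Pi.add_apply, Fin.cons_succ,
      Finset.sum_apply, Pi.mul_apply, Pi.natCast_apply, Pi.sub_apply, ne_eq, Fin.succ_ne_zero,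
      not_false_eq_true, Pi.single_eq_of_ne, Pi.single_apply, Fin.succ_inj, zero_sub, mul_neg,
      mul_ite, mul_one, mul_zero, Finset.sum_neg_distrib, Finset.sum_ite_eq, Finset.mem_univ,
      ↓reduceIte, raise]
    ring

theorem lowerLeft_cons {l l' : ℕ} (d : Fin l' → ℕ) (d₀ : Fin l × Fin l' → ℕ) (n : ℤ)
    (α : Fin l → ℤ) :
    lowerLeft (Sum.elim d d₀ ∘ (boxEquiv l l').symm) (Fin.cons n α : Fin (l + 1) → ℤ) =
      Fin.cons (n - ∑ a, (d a : ℤ)) (lowerLeft d₀ α) := by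
  rw [lowerLeft, ← Equiv.sum_comp (boxEquiv l l'), Fintype.sum_sum_type]
  simp only [Function.comp_apply, Equiv.symm_apply_apply, Sum.elim_inl, Sum.elim_inr]
  funext i
  induction i using Fin.cases with
  | zero => simp [boxEquiv_inl, boxEquiv_inr, Finset.sum_apply, (Fin.succ_ne_zero _).symm]
  | succ i => simp [boxEquiv_inl, boxEquiv_inr, Finset.sum_apply, Pi.single_apply, lowerLeft]

theorem lowerRight_cons {l l' : ℕ} (d : Fin l' → ℕ) (d₀ : Fin l × Fin l' → ℕ) (β : Fin l' → ℤ) :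
    lowerRight (Sum.elim d d₀ ∘ (boxEquiv l l').symm) β = fun a => lowerRight d₀ β a - d a := by
  rw [lowerRight, ← Equiv.sum_comp (boxEquiv l l'), Fintype.sum_sum_type]
  simp only [Function.comp_apply, Equiv.symm_apply_apply, Sum.elim_inl, Sum.elim_inr]
  funext a
  simp only [boxEquiv_inl, zsmul_eq_mul, Int.cast_natCast, boxEquiv_inr, Pi.sub_apply,
    Pi.add_apply, Finset.sum_apply, Pi.mul_apply, Pi.natCast_apply, Pi.single_apply, mul_ite,
    mul_one, mul_zero, Finset.sum_ite_eq, Finset.mem_univ, ↓reduceIte, lowerRight]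
  ring

theorem lowerLeft_sub {l l' : ℕ} (d : Fin l × Fin l' → ℕ) (α γ : Fin l → ℤ) :
    lowerLeft d (α - γ) = lowerLeft d α - γ := by
  rw [lowerLeft, lowerLeft, sub_right_comm]

theorem term_cons {l l' : ℕ} (n : ℤ) (α : Fin l → ℤ) (β : Fin l' → ℤ)
    (e : (Pairs l → ℕ) × (Pairs l' → ℕ) × (Fin l × Fin l' → ℕ))
    (s : (Fin l → ℕ) × (Fin l' → ℕ)) :
    term (Fin.cons n α : Fin (l + 1) → ℤ) β (exponentsEquiv l l' (e, s)) =
      ((∏ p, raiseCoeff (e.1 p)) * (∏ p, raiseCoeff (e.2.1 p)) * ∏ p, lowerCoeff (e.2.2 p)) •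
        ((∏ i, raiseCoeff (s.1 i)) * ∏ a, lowerCoeff (s.2 a)) •
          (q x (n + ∑ i, (s.1 i : ℤ) - ∑ a, (s.2 a : ℤ)) *
            qPair (fun i => lowerLeft e.2.2 (raise e.1 α) i - s.1 i)
              fun a => lowerRight e.2.2 (raise e.2.1 β) a - s.2 a) := by
  have lowerLeft_raise_sub : lowerLeft e.2.2 (fun i => raise e.1 α i - s.1 i) =
      fun i => lowerLeft e.2.2 (raise e.1 α) i - s.1 i := lowerLeft_sub _ _ _
  simp only [term, exponentsEquiv, Equiv.coe_fn_mk]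
  rw [raise_cons, lowerLeft_cons, lowerRight_cons, lowerLeft_raise_sub, smul_smul,
    ← Equiv.prod_comp (pairsEquiv l), ← Equiv.prod_comp (boxEquiv l l'), Fintype.prod_sum_type,
    Fintype.prod_sum_type]
  congr 1
  · simp only [Function.comp_apply, Equiv.symm_apply_apply, Sum.elim_inl, Sum.elim_inr]
    ring
  · rw [qPair, Fin.prod_univ_succ, qPair, mul_assoc]
    simp only [Fin.cons_zero, Fin.cons_succ]

/-- The raising operator formula that defines `Q_{[λ,μ]}`, for arbitrary integer sequences in place
of `λ` and `μ`. -/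
def coupledQ {l l' : ℕ} (α : Fin l → ℤ) (β : Fin l' → ℤ) : A := ∑ᶠ e, term α β e

theorem coupledQ_cons {l l' : ℕ} (n : ℤ) (α : Fin l → ℤ) (β : Fin l' → ℤ) :
    coupledQ (Fin.cons n α : Fin (l + 1) → ℤ) β = vertexOp n (coupledQ α β) := by
  rw [coupledQ, coupledQ, map_finsum _ (term_support_finite α β),
    ← finsum_comp_equiv (exponentsEquiv l l'), finsum_curry]
  · refine finsum_congr fun e => ?_
    rw [term, map_smul, vertexOp_qPair_finsum, smul_finsum]
    exact finsum_congr fun s => term_cons n α β e s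
  · exact (term_support_finite (Fin.cons n α : Fin (l + 1) → ℤ) β).preimage
      (exponentsEquiv l l').injective.injOn

end Prepend

/-! ### The Pieri rule for partitions as lists -/

section Strips

/-- Weakly decreasing lists of nonnegative integers. -/
def IsPartition : List ℤ → Prop
  | [] => True
  | n :: α => α.headD 0 ≤ n ∧ IsPartition α

/-- The sequences `(ν₂, …, ν_{l+1})` for the partitions `ν` of length at most `l + 1` that interlace
with a given partition of length at most `l`. -/
def strips : List ℤ → Finset (List ℤ)
  | [] => {[]}
  | n :: α => (strips α ×ˢ Finset.Icc (α.headD 0) n).image fun p => p.2 :: p.1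

theorem sum_strips_cons {V : Type*} [AddCommMonoid V] (n : ℤ) (α : List ℤ) (F : List ℤ → V) :
    ∑ ρ ∈ strips (n :: α), F ρ =
      ∑ ρ ∈ strips α, ∑ c ∈ Finset.Icc (α.headD 0) n, F (c :: ρ) := by
  rw [strips, Finset.sum_image, Finset.sum_product]
  rintro ⟨a, b⟩ _ ⟨c, d⟩ _ h
  simp only [List.cons.injEq] at h
  rw [h.1, h.2]

theorem mem_strips_cons {n : ℤ} {α ρ : List ℤ} :
    ρ ∈ strips (n :: α) ↔ ∃ c ρ', ρ = c :: ρ' ∧ α.headD 0 ≤ c ∧ c ≤ n ∧ ρ' ∈ strips α := by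
  simp only [strips, Finset.mem_image, Finset.mem_product, Finset.mem_Icc, Prod.exists]
  constructor
  · rintro ⟨ρ', c, ⟨hρ', hc, hcn⟩, rfl⟩
    exact ⟨c, ρ', rfl, hc, hcn, hρ'⟩
  · rintro ⟨c, ρ', rfl, hc, hcn, hρ'⟩
    exact ⟨ρ', c, ⟨hρ', hc, hcn⟩, rfl⟩

theorem sum_le_of_mem_strips {α ρ : List ℤ} (h : ρ ∈ strips α) : α.sum ≤ α.headD 0 + ρ.sum := by
  induction α generalizing ρ with
  | nil => simp [Finset.mem_singleton.1 h]
  | cons n α ih =>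
    obtain ⟨c, ρ', rfl, hc, -, hρ'⟩ := mem_strips_cons.1 h
    have := ih hρ'
    simp only [List.sum_cons, List.headD_cons]
    omega

variable {k : Type*} [CommRing k]

/-- The coefficient `ψ_{ν/α}(τ)` for `ν = (r, ρ)` with `ρ ∈ strips α`, and `0` for `r < α₁`. The
recursion is the one that the commutation relations of the vertex operators impose, see
`q_xOp_vertexOps`; for the product formula see `psiProd_cons_eq_pieriCoeff`. -/
def pieriCoeff (τ : k) : List ℤ → List ℤ → ℤ → k
  | [], _, r => if r < 0 then 0 else 1
  | _ :: _, [], _ => 0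
  | n :: α, c :: ρ, r =>
    if r < n then 0
    else if r = n then pieriCoeff τ α ρ c
    else (1 - τ) * pieriCoeff τ α ρ c + if c = n then τ * pieriCoeff τ α ρ (n + 1) else 0

theorem pieriCoeff_of_lt (τ : k) {α : List ℤ} (ρ : List ℤ) {r : ℤ} (hr : r < α.headD 0) :
    pieriCoeff τ α ρ r = 0 := by
  rcases α with _ | ⟨n, α⟩
  · exact if_pos hr
  · rcases ρ with _ | ⟨c, ρ⟩
    · rfl
    · exact if_pos hr

theorem pieriCoeff_congr (τ : k) {α : List ℤ} (ρ : List ℤ) {r r' : ℤ} (hr : α.headD 0 < r)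
    (hr' : α.headD 0 < r') : pieriCoeff τ α ρ r = pieriCoeff τ α ρ r' := by
  rcases α with _ | ⟨n, α⟩
  · exact (if_neg hr.not_gt).trans (if_neg hr'.not_gt).symm
  · rcases ρ with _ | ⟨c, ρ⟩
    · rfl
    · rw [List.headD_cons] at hr hr'
      rw [pieriCoeff, pieriCoeff, if_neg hr.not_gt, if_neg hr'.not_gt, if_neg hr.ne',
        if_neg hr'.ne']

variable {V : Type*} [AddCommGroup V] [Module k V]

theorem sum_pieriCoeff_cons_smul (τ : k) (α ρ : List ℤ) {n : ℤ} (hn : α.headD 0 ≤ n) (r : ℤ)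
    (S : ℤ → V) :
    ∑ c ∈ Finset.Icc (α.headD 0) n, pieriCoeff τ (n :: α) (c :: ρ) (n + r - c) • S c =
      (1 - τ) • ∑ c ∈ Finset.Icc (α.headD 0) (min n r), pieriCoeff τ α ρ c • S c +
        (τ * pieriCoeff τ α ρ r) • S (min n r) := by
  have coeff_eq (c : ℤ) : pieriCoeff τ (n :: α) (c :: ρ) (n + r - c) =
      (if c ≤ r then (1 - τ) * pieriCoeff τ α ρ c else 0) +
        ((if c = r then τ * pieriCoeff τ α ρ r else 0) +
        (if c = n then (if n < r then τ * pieriCoeff τ α ρ (n + 1) else 0) else 0)) := by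
    rw [pieriCoeff]
    split_ifs <;> first | omega | (subst_vars; ring1)
  have sum_le : ∑ c ∈ Finset.Icc (α.headD 0) n,
      (if c ≤ r then ((1 - τ) * pieriCoeff τ α ρ c) • S c else 0) =
      (1 - τ) • ∑ c ∈ Finset.Icc (α.headD 0) (min n r), pieriCoeff τ α ρ c • S c := by
    rw [← Finset.sum_filter, Finset.smul_sum]
    refine Finset.sum_congr ?_ fun c _ => mul_smul _ _ _
    ext c
    simp only [Finset.mem_filter, Finset.mem_Icc, le_min_iff, and_assoc]
  simp only [coeff_eq, add_smul, ite_smul, zero_smul, Finset.sum_add_distrib, sum_le,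
    Finset.sum_ite_eq', Finset.mem_Icc]
  congr 1
  rcases lt_or_ge n r with hnr | hrn
  · rw [if_neg fun h => h.2.not_gt hnr, if_pos ⟨hn, le_rfl⟩, if_pos hnr, min_eq_left hnr.le,
      zero_add, pieriCoeff_congr τ ρ (r' := r) (by omega) (by omega)]
  · rw [if_neg hrn.not_gt, ite_self, add_zero, min_eq_right hrn]
    split_ifs with hr
    · rfl
    · rw [pieriCoeff_of_lt τ ρ (by omega), mul_zero, zero_smul]

theorem sum_Icc_pieriCoeff_smul (τ : k) (α ρ : List ℤ) (r : ℤ) (S : ℤ → V) :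
    ∑ c ∈ Finset.Icc (α.headD 0) r, pieriCoeff τ α ρ c • S c =
      ∑ c ∈ Finset.Icc (α.headD 0) (r - 1), pieriCoeff τ α ρ c • S c +
        pieriCoeff τ α ρ r • S r := by
  rcases lt_or_ge r (α.headD 0) with hr | hr
  · rw [pieriCoeff_of_lt τ ρ hr, Finset.Icc_eq_empty hr.not_ge, Finset.Icc_eq_empty (by omega),
      zero_smul, Finset.sum_empty, zero_add]
  · have insert_Icc :=
      Finset.insert_Icc_right_eq_Icc_add_one (a := α.headD 0) (b := r - 1) (by omega)
    rw [sub_add_cancel] at insert_Icc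
    rw [← insert_Icc, Finset.sum_insert (by simp), add_comm]

theorem sum_pieriCoeff_cons_smul_sub {k V : Type*} [Field k] [CharZero k] [AddCommGroup V]
    [Module k V] (τ : k) (α ρ : List ℤ) {n : ℤ} (hn : α.headD 0 ≤ n) (r : ℤ) (S : ℤ → V)
    (hS : S r - τ • S (r - 1) = τ • S n - S (n + 1)) :
    ∑ c ∈ Finset.Icc (α.headD 0) n, pieriCoeff τ (n :: α) (c :: ρ) (n + r - c) • S c -
      ∑ c ∈ Finset.Icc (α.headD 0) (n + 1), pieriCoeff τ ((n + 1) :: α) (c :: ρ) (n + r - c) • S c =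
      pieriCoeff τ α ρ r • S r - τ • pieriCoeff τ α ρ (r - 1) • S (r - 1) := by
  have sum_succ := sum_pieriCoeff_cons_smul τ α ρ (hn.trans (lt_add_one n).le) (r - 1) S
  rw [add_add_sub_cancel] at sum_succ
  rw [sum_pieriCoeff_cons_smul τ α ρ hn, sum_succ]
  rcases lt_trichotomy r (n + 1) with hr | rfl | hr
  · rw [min_eq_right (by omega), min_eq_right (by omega), sum_Icc_pieriCoeff_smul τ α ρ r]
    module
  · rw [add_sub_cancel_right] at hS ⊢
    have S_succ : S (n + 1) = τ • S n := by
      have two_smul_eq : (2 : k) • S (n + 1) = (2 : k) • τ • S n := by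
        linear_combination (norm := module) hS
      exact smul_right_injective V two_ne_zero two_smul_eq
    rw [min_eq_left (by omega), min_eq_right (by omega), S_succ]
    module
  · rw [min_eq_left (by omega), min_eq_left (by omega), sum_Icc_pieriCoeff_smul τ α ρ (n + 1),
      add_sub_cancel_right, pieriCoeff_congr τ ρ (r := n + 1) (r' := r) (by omega) (by omega),
      pieriCoeff_congr τ ρ (r := r - 1) (r' := r) (by omega) (by omega)]
    linear_combination (norm := module) (-pieriCoeff τ α ρ r) • hS

/-- The vector `B_{α₁} ⋯ B_{α_l} v`, where `B_n = vertexOp n`. -/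
def vertexOps (α : List ℤ) (v : A) : A := α.foldr (fun n => vertexOp n) v

theorem vertexOps_cons (n : ℤ) (α : List ℤ) (v : A) :
    vertexOps (n :: α) v = vertexOp n (vertexOps α v) := rfl

theorem q_xOp_vertexOp_vertexOps {α : List ℤ} {v : A}
    (pieri : ∀ m, q xOp m (vertexOps α v) = ∑ ρ ∈ strips α,
      pieriCoeff t α ρ (m + α.sum - ρ.sum) • vertexOps ((m + α.sum - ρ.sum) :: ρ) v)
    {n : ℤ} (hn : α.headD 0 ≤ n) (m : ℤ) :
    q xOp m (vertexOp n (vertexOps α v)) = ∑ ρ ∈ strips α, ∑ c ∈ Finset.Icc (α.headD 0) n,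
      pieriCoeff t (n :: α) (c :: ρ) (n + (m + α.sum - ρ.sum) - c) •
        vertexOp (n + (m + α.sum - ρ.sum) - c) (vertexOp c (vertexOps ρ v)) := by
  obtain ⟨k, hk⟩ : ∃ k : ℕ, m < k := ⟨m.toNat + 1, by omega⟩
  induction k generalizing m n with
  | zero =>
    rw [q_of_neg _ (by exact_mod_cast hk), LinearMap.zero_apply]
    refine (Finset.sum_eq_zero fun ρ hρ => Finset.sum_eq_zero fun c hc => ?_).symm
    have := sum_le_of_mem_strips hρ
    rw [Finset.mem_Icc] at hc
    rw [pieriCoeff_of_lt _ _ (by rw [List.headD_cons]; push_cast at hk; omega), zero_smul]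
  | succ k ih =>
    have commutation := vertexOp_q_xOp_sub n m (vertexOps α v)
    have previous := ih (n := n + 1) (by omega) (m - 1) (by push_cast at hk; omega)
    rw [eq_comm, sub_eq_iff_eq_add] at commutation
    rw [commutation, previous, pieri, pieri]
    simp only [map_sum, Finset.smul_sum]
    rw [← Finset.sum_sub_distrib, ← Finset.sum_add_distrib]
    refine Finset.sum_congr rfl fun ρ _ => ?_
    generalize hr : m + α.sum - ρ.sum = r
    have pred_eq : m - 1 + α.sum - ρ.sum = r - 1 := by rw [← hr]; ring
    have index_eq : n + r - (r - 1) = n + 1 := by ring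
    have straightening := vertexOp_vertexOp n r (vertexOps ρ v)
    have strip := sum_pieriCoeff_cons_smul_sub t α ρ hn r
      (fun c => vertexOp (n + r - c) (vertexOp c (vertexOps ρ v))) ?_
    · rw [sub_eq_iff_eq_add] at strip
      rw [strip, pred_eq, add_add_sub_cancel, add_sub_cancel_right, index_eq]
      simp only [map_smul, vertexOps_cons]
    · rwa [add_sub_cancel_right, index_eq, add_sub_cancel_left, add_sub_add_left_eq_sub]

theorem q_xOp_vertexOps {α : List ℤ} (hα : IsPartition α) {v : A}
    (hv : ∀ n, vertexOp n v = q xOp n v) (m : ℤ) :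
    q xOp m (vertexOps α v) = ∑ ρ ∈ strips α,
      pieriCoeff t α ρ (m + α.sum - ρ.sum) • vertexOps ((m + α.sum - ρ.sum) :: ρ) v := by
  induction α generalizing m with
  | nil =>
    rw [strips, Finset.sum_singleton, List.sum_nil, add_zero, sub_zero, vertexOps_cons, pieriCoeff]
    change q xOp m v = _ • vertexOp m v
    rw [hv]
    split_ifs with hm
    · rw [q_of_neg _ hm, LinearMap.zero_apply, smul_zero]
    · rw [one_smul]
  | cons n α ih =>
    rw [vertexOps_cons, q_xOp_vertexOp_vertexOps (ih hα.2) hα.1, sum_strips_cons]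
    refine Finset.sum_congr rfl fun ρ _ => Finset.sum_congr rfl fun c _ => ?_
    have part_eq : m + (n :: α).sum - (c :: ρ).sum = n + (m + α.sum - ρ.sum) - c := by
      simp only [List.sum_cons]
      ring
    rw [part_eq, vertexOps_cons, vertexOps_cons]

end Strips

/-! ### Coefficients as products over multiplicities -/

section Multiplicities

variable {α ρ : List ℤ}

theorem headD_nonneg_of_mem_strips (hρ : ρ ∈ strips α) : 0 ≤ α.headD 0 := by
  induction α generalizing ρ with
  | nil => exact le_rfl
  | cons n α ih =>
    obtain ⟨c, ρ', -, hc, hcn, hρ'⟩ := mem_strips_cons.1 hρ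
    exact (ih hρ').trans (hc.trans hcn)

theorem le_headD_of_mem_of_mem_strips (hρ : ρ ∈ strips α) {a : ℤ} (ha : a ∈ α) :
    a ≤ α.headD 0 := by
  induction α generalizing ρ with
  | nil => exact absurd ha List.not_mem_nil
  | cons n α ih =>
    obtain ⟨c, ρ', -, hc, hcn, hρ'⟩ := mem_strips_cons.1 hρ
    rcases List.mem_cons.1 ha with rfl | ha
    · exact le_rfl
    · exact (ih hρ' ha).trans (hc.trans hcn)

theorem le_headD_of_mem_strips (hρ : ρ ∈ strips α) {a : ℤ} (ha : a ∈ ρ) : a ≤ α.headD 0 := by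
  induction α generalizing ρ with
  | nil =>
    rw [strips, Finset.mem_singleton] at hρ
    exact absurd (hρ ▸ ha) List.not_mem_nil
  | cons n α ih =>
    obtain ⟨c, ρ', rfl, hc, hcn, hρ'⟩ := mem_strips_cons.1 hρ
    rcases List.mem_cons.1 ha with rfl | ha
    · exact hcn
    · exact (ih hρ' ha).trans (hc.trans hcn)

theorem count_eq_zero_of_headD_lt (hρ : ρ ∈ strips α) {j : ℤ} (hj : α.headD 0 < j) :
    α.count j = 0 ∧ ρ.count j = 0 :=
  ⟨List.count_eq_zero_of_not_mem fun h => (le_headD_of_mem_of_mem_strips hρ h).not_gt hj,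
    List.count_eq_zero_of_not_mem fun h => (le_headD_of_mem_strips hρ h).not_gt hj⟩

theorem count_le_of_mem_strips (hρ : ρ ∈ strips α) (j : ℤ) : α.count j ≤ ρ.count j + 1 := by
  induction α generalizing ρ with
  | nil => simp
  | cons n α ih =>
    obtain ⟨c, ρ', rfl, hc, hcn, hρ'⟩ := mem_strips_cons.1 hρ
    have tail_le := ih hρ'
    have tail_zero (h : c < j) := (count_eq_zero_of_headD_lt hρ' (hc.trans_lt h)).1
    simp only [List.count_cons, beq_iff_eq]
    split_ifs <;> omega

theorem count_le_of_cons_mem_strips {n c : ℤ} (hρ : c :: ρ ∈ strips (n :: α)) :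
    α.count n ≤ (c :: ρ).count n := by
  simpa using count_le_of_mem_strips hρ n

variable {k : Type*} [CommRing k]

/-- The product formula for `ψ_{ν/α}(τ)`, where `ν` and `α` are given by their lists of parts: there
is a factor `1 - τ^{m_j(α)}` for each `j ≥ 1` with `m_j(ν) < m_j(α)`. -/
def psiProd (τ : k) (ν α : List ℤ) : k :=
  ∏ᶠ j : ℤ, if 0 < j ∧ ν.count j < α.count j then 1 - τ ^ α.count j else 1

theorem psiProd_cons_cons_self (τ : k) {ν α : List ℤ} {n : ℤ} (h : α.count n ≤ ν.count n) :
    psiProd τ (n :: ν) (n :: α) = psiProd τ ν α := by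
  refine finprod_congr fun j => ?_
  rcases eq_or_ne j n with rfl | hj
  · rw [if_neg (by simp [h]), if_neg (by simp [h])]
  · rw [List.count_cons_of_ne hj.symm, List.count_cons_of_ne hj.symm]

theorem finite_mulSupport_psiProd (τ : k) (ν α : List ℤ) :
    (Function.mulSupport fun j : ℤ =>
      if 0 < j ∧ ν.count j < α.count j then 1 - τ ^ α.count j else 1).Finite := by
  refine α.toFinset.finite_toSet.subset fun j hj => ?_
  by_contra hjα
  refine hj (if_neg ?_)
  rw [List.count_eq_zero_of_not_mem fun h => hjα (List.mem_toFinset.2 h)]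
  simp

theorem psiProd_eq_mul_psiProd_cons (τ : k) {ν α : List ℤ} {n : ℤ}
    (h : α.count n ≤ ν.count n + 1) :
    psiProd τ ν α = (if 0 < n ∧ ν.count n < α.count n then 1 - τ ^ α.count n else 1) *
      psiProd τ (n :: ν) α := by
  let factor : k := if 0 < n ∧ ν.count n < α.count n then 1 - τ ^ α.count n else 1
  have single_eq : ∏ᶠ j : ℤ, (if j = n then factor else 1) = factor := by
    rw [finprod_eq_single _ n fun j hj => if_neg hj, if_pos rfl]
  have single_finite : (Function.mulSupport fun j : ℤ => if j = n then factor else 1).Finite :=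
    (Set.finite_singleton n).subset fun j hj => by_contra fun h => hj (if_neg h)
  change _ = factor * _
  rw [psiProd, psiProd, ← single_eq,
    ← finprod_mul_distrib single_finite (finite_mulSupport_psiProd τ (n :: ν) α)]
  refine finprod_congr fun j => ?_
  rcases eq_or_ne j n with rfl | hj
  · rw [List.count_cons_self, if_pos rfl,
      if_neg (c := 0 < j ∧ ν.count j + 1 < α.count j) (by omega), mul_one]
  · rw [List.count_cons_of_ne hj.symm, if_neg hj, one_mul]

theorem psiProd_cons_of_headD_lt (τ : k) (hρ : ρ ∈ strips α) (ν : List ℤ) {r : ℤ}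
    (hr : α.headD 0 < r) : psiProd τ (r :: ν) α = psiProd τ ν α := by
  have count_eq := (count_eq_zero_of_headD_lt hρ hr).1
  rw [psiProd_eq_mul_psiProd_cons τ (ν := ν) (n := r) (by omega), if_neg (by omega), one_mul]

theorem psiProd_cons_eq_pieriCoeff (τ : k) {r : ℤ} (hρ : ρ ∈ strips α) (hr : α.headD 0 ≤ r) :
    psiProd τ (r :: ρ) α = pieriCoeff τ α ρ r := by
  induction α generalizing ρ r with
  | nil =>
    have nonneg : ¬ r < 0 := hr.not_gt
    simp [psiProd, pieriCoeff, nonneg]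
  | cons n α ih =>
    obtain ⟨c, ρ, rfl, hc, hcn, hρ'⟩ := mem_strips_cons.1 hρ
    have count_le := count_le_of_cons_mem_strips hρ
    have nr : n ≤ r := hr
    rw [pieriCoeff, if_neg nr.not_gt]
    rcases nr.eq_or_lt with rfl | nr
    · rw [if_pos rfl, psiProd_cons_cons_self τ count_le, ih hρ' hc]
    rw [if_neg nr.ne', psiProd_cons_of_headD_lt τ hρ _ nr,
      psiProd_eq_mul_psiProd_cons τ (n := n) (by simpa using count_le),
      psiProd_cons_cons_self τ count_le, List.count_cons_self]
    rcases hcn.eq_or_lt with rfl | hcn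
    · rw [if_pos rfl, ← ih hρ' hc, ← ih hρ' (r := c + 1) (by omega),
        psiProd_cons_of_headD_lt τ hρ' ρ (r := c + 1) (by omega),
        psiProd_eq_mul_psiProd_cons τ (count_le_of_mem_strips hρ' c), List.count_cons_self]
      simp only [add_lt_add_iff_right]
      split_ifs <;> ring
    · have counts := count_eq_zero_of_headD_lt hρ' (hc.trans_lt hcn)
      have n_pos := ((headD_nonneg_of_mem_strips hρ').trans hc).trans_lt hcn
      rw [if_neg hcn.ne, add_zero, ← ih hρ' hc, List.count_cons_of_ne hcn.ne, counts.1, counts.2,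
        if_pos (by omega), zero_add, pow_one]

end Multiplicities

/-! ### Young diagrams -/

section RowLists

/-- The list `(f 0, …, f (k - 1))`. -/
def rowList (f : ℕ → ℕ) (k : ℕ) : List ℤ := (List.range k).map fun i => (f i : ℤ)

theorem rowList_zero (f : ℕ → ℕ) : rowList f 0 = [] := rfl

theorem rowList_succ (f : ℕ → ℕ) (k : ℕ) :
    rowList f (k + 1) = (f 0 : ℤ) :: rowList (fun i => f (i + 1)) k := by
  simp only [rowList, List.range_succ_eq_map, List.map_cons, List.map_map, Function.comp_def,
    Nat.succ_eq_add_one]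

theorem headD_rowList {f : ℕ → ℕ} {k : ℕ} (hk : f k = 0) : (rowList f k).headD 0 = f 0 := by
  rcases k with _ | k
  · rw [rowList_zero, hk, List.headD_nil, Nat.cast_zero]
  · rw [rowList_succ, List.headD_cons]

theorem isPartition_rowList {f : ℕ → ℕ} (hf : Antitone f) {k : ℕ} (hk : f k = 0) :
    IsPartition (rowList f k) := by
  induction k generalizing f with
  | zero => trivial
  | succ k ih =>
    rw [rowList_succ]
    refine ⟨?_, ih (fun i j h => hf (by omega)) hk⟩
    rw [headD_rowList (f := fun i => f (i + 1)) hk]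
    exact_mod_cast hf (Nat.zero_le 1)

theorem rowList_mem_strips_iff {f : ℕ → ℕ} (g : ℕ → ℕ) {k : ℕ} (hk : f k = 0) :
    rowList g k ∈ strips (rowList f k) ↔ ∀ i < k, f (i + 1) ≤ g i ∧ g i ≤ f i := by
  induction k generalizing f g with
  | zero => simp [rowList_zero, strips]
  | succ k ih =>
    have tail_iff := ih (f := fun i => f (i + 1)) (fun i => g (i + 1)) hk
    rw [rowList_succ, rowList_succ, mem_strips_cons,
      headD_rowList (f := fun i => f (i + 1)) hk]
    constructor
    · rintro ⟨c, ρ, hcons, hc, hcn, hρ⟩ i hi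
      obtain ⟨rfl, rfl⟩ := List.cons.inj hcons
      rcases i with _ | i
      · exact ⟨by exact_mod_cast hc, by exact_mod_cast hcn⟩
      · exact tail_iff.1 hρ i (by omega)
    · intro h
      exact ⟨_, _, rfl, by exact_mod_cast (h 0 (by omega)).1,
        by exact_mod_cast (h 0 (by omega)).2, tail_iff.2 fun i hi => h (i + 1) (by omega)⟩

theorem exists_rowList_of_mem_strips {f : ℕ → ℕ} {k : ℕ} (hk : f k = 0) {ρ : List ℤ}
    (hρ : ρ ∈ strips (rowList f k)) : ∃ g : ℕ → ℕ, (∀ i, k ≤ i → g i = 0) ∧ ρ = rowList g k := by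
  induction k generalizing f ρ with
  | zero =>
    rw [rowList_zero, strips, Finset.mem_singleton] at hρ
    exact ⟨fun _ => 0, fun _ _ => rfl, hρ⟩
  | succ k ih =>
    rw [rowList_succ] at hρ
    obtain ⟨c, ρ', rfl, hc, -, hρ'⟩ := mem_strips_cons.1 hρ
    obtain ⟨g, hg, rfl⟩ := ih hk hρ'
    rw [headD_rowList (f := fun i => f (i + 1)) hk] at hc
    refine ⟨fun i => Nat.casesOn i c.toNat g, ?_, ?_⟩
    · rintro (_ | i) hi
      · omega
      · exact hg i (by omega)
    · rw [rowList_succ]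
      exact congrArg (· :: rowList g k) (Int.toNat_of_nonneg (by omega : 0 ≤ c)).symm

theorem eq_of_rowList_eq {f g : ℕ → ℕ} {k : ℕ} (h : rowList f k = rowList g k) {i : ℕ}
    (hi : i < k) : f i = g i :=
  Nat.cast_injective (List.map_inj_left.1 h i (List.mem_range.2 hi))

theorem sum_rowList (f : ℕ → ℕ) (k : ℕ) :
    (rowList f k).sum = ((∑ i ∈ Finset.range k, f i : ℕ) : ℤ) := by
  rw [Nat.cast_sum]
  rfl

theorem rowList_add {f : ℕ → ℕ} {k : ℕ} (hk : ∀ i, k ≤ i → f i = 0) (j : ℕ) :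
    rowList f (k + j) = rowList f k ++ List.replicate j 0 := by
  rw [rowList, List.range_add, List.map_append, List.map_map]
  congr 1
  refine List.eq_replicate_iff.2 ⟨by rw [List.length_map, List.length_range], fun b hb => ?_⟩
  obtain ⟨i, -, rfl⟩ := List.mem_map.1 hb
  exact congrArg Nat.cast (hk (k + i) (by omega))

theorem vertexOps_append_replicate_zero {v : A} (hv : vertexOp 0 v = v) (α : List ℤ) (j : ℕ) :
    vertexOps (α ++ List.replicate j 0) v = vertexOps α v := by
  rw [vertexOps, List.foldr_append]
  congr 1
  induction j with
  | zero => rfl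
  | succ j ih => rw [List.replicate_succ, List.foldr_cons, ih, hv]

end RowLists

section YoungDiagrams

theorem rowLen_le_iff (ν : YoungDiagram) (i j : ℕ) : ν.rowLen i ≤ j ↔ ν.colLen j ≤ i := by
  rw [← not_lt, ← not_lt, ← YoungDiagram.mem_iff_lt_rowLen, ← YoungDiagram.mem_iff_lt_colLen]

theorem rowLen_eq_zero (ν : YoungDiagram) {i : ℕ} (hi : ν.colLen 0 ≤ i) : ν.rowLen i = 0 :=
  Nat.le_zero.1 ((rowLen_le_iff ν i 0).2 hi)

theorem rowLen_injective : Function.Injective YoungDiagram.rowLen := by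
  refine fun ν ν' h => SetLike.ext fun ⟨i, j⟩ => ?_
  rw [YoungDiagram.mem_iff_lt_rowLen, YoungDiagram.mem_iff_lt_rowLen, h]

theorem exists_youngDiagram {f : ℕ → ℕ} (hf : Antitone f) {k : ℕ} (hk : f k = 0) :
    ∃ ν : YoungDiagram, ν.rowLen = f := by
  have sorted : ((List.range k).map f).SortedGE := by
    rw [List.sortedGE_iff_pairwise, List.pairwise_map]
    exact List.pairwise_lt_range.imp fun h => hf h.le
  refine ⟨YoungDiagram.ofRowLens _ sorted, funext fun i => eq_of_forall_lt_iff fun j => ?_⟩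
  rw [← YoungDiagram.mem_iff_lt_rowLen, YoungDiagram.mem_ofRowLens]
  simp only [List.length_map, List.length_range, List.getElem_map, List.getElem_range,
    exists_prop, and_iff_right_iff_imp]
  intro hj
  by_contra! hi
  have := hf hi
  omega

theorem card_eq_sum_rowLen (ν : YoungDiagram) {k : ℕ} (hk : ν.colLen 0 ≤ k) :
    ν.card = ∑ i ∈ Finset.range k, ν.rowLen i := by
  rw [YoungDiagram.card, Finset.card_eq_sum_card_fiberwise (f := Prod.fst) (t := Finset.range k)]
  · refine Finset.sum_congr rfl fun i _ => ?_
    rw [YoungDiagram.rowLen_eq_card]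
    rfl
  · rintro ⟨i, j⟩ hij
    have hi : i < ν.colLen j := YoungDiagram.mem_iff_lt_colLen.1 hij
    exact Finset.mem_coe.2 <|
      Finset.mem_range.2 <| hi.trans_le <| (ν.colLen_anti 0 j j.zero_le).trans hk

theorem count_rowLens_add_colLen (ν : YoungDiagram) {j : ℕ} (hj : 1 ≤ j) :
    ν.rowLens.count j + ν.colLen j = ν.colLen (j - 1) := by
  have count_eq : ν.rowLens.count j = (Finset.Ico (ν.colLen j) (ν.colLen (j - 1))).card := by
    rw [YoungDiagram.rowLens, List.count, List.countP_map, List.countP_eq_length_filter,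
      ← List.toFinset_card_of_nodup (List.nodup_range.filter _)]
    congr 1
    ext i
    have := rowLen_le_iff ν i j
    have := rowLen_le_iff ν i (j - 1)
    have := ν.colLen_anti 0 (j - 1) (Nat.zero_le _)
    simp only [List.mem_toFinset, List.mem_filter, List.mem_range, Function.comp_apply,
      beq_iff_eq, Finset.mem_Ico]
    omega
  rw [count_eq, Nat.card_Ico, Nat.sub_add_cancel (ν.colLen_anti _ _ (Nat.sub_le _ _))]

theorem count_rowList_rowLen (ν : YoungDiagram) {k : ℕ} (hk : ν.colLen 0 ≤ k) {j : ℕ}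
    (hj : 1 ≤ j) : (rowList ν.rowLen k).count (j : ℤ) = ν.rowLens.count j := by
  obtain ⟨i, rfl⟩ := Nat.exists_eq_add_of_le hk
  have rowList_eq : rowList ν.rowLen (ν.colLen 0) = ν.rowLens.map (Nat.cast : ℕ → ℤ) := by
    rw [rowList, YoungDiagram.rowLens, List.map_map]
    rfl
  rw [rowList_add (fun i hi => rowLen_eq_zero ν hi), List.count_append, rowList_eq,
    List.count_map_of_injective _ _ Nat.cast_injective, List.count_replicate,
    if_neg (by rw [beq_iff_eq]; omega), add_zero]

theorem colLen_le_of_interlaces {ν lam : YoungDiagram} (h : Interlaces ν lam) :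
    ν.colLen 0 ≤ lam.colLen 0 + 1 := by
  rw [← rowLen_le_iff]
  exact (h (lam.colLen 0)).2.trans_eq (rowLen_eq_zero lam le_rfl)

theorem card_le_of_interlaces {ν lam : YoungDiagram} (h : Interlaces ν lam) :
    lam.card ≤ ν.card := by
  rw [card_eq_sum_rowLen lam (Nat.le_succ (lam.colLen 0)),
    card_eq_sum_rowLen ν (colLen_le_of_interlaces h)]
  exact Finset.sum_le_sum fun i _ => (h i).1

theorem exists_interlaces {lam : YoungDiagram} {f : ℕ → ℕ}
    (h : ∀ i, lam.rowLen i ≤ f i ∧ f (i + 1) ≤ lam.rowLen i) :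
    ∃ ν, Interlaces ν lam ∧ ν.rowLen = f := by
  have antitone : Antitone f := antitone_nat_of_succ_le fun i => (h i).2.trans (h i).1
  have vanishing : f (lam.colLen 0 + 1) = 0 :=
    Nat.le_zero.1 ((h (lam.colLen 0)).2.trans_eq (rowLen_eq_zero lam le_rfl))
  obtain ⟨ν, rfl⟩ := exists_youngDiagram antitone vanishing
  exact ⟨ν, h, rfl⟩

/-- The nonzero parts of `λ`, in decreasing order. -/
def parts (lam : YoungDiagram) : List ℤ := rowList lam.rowLen (lam.colLen 0)

theorem isPartition_parts (lam : YoungDiagram) : IsPartition (parts lam) :=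
  isPartition_rowList (fun i j h => lam.rowLen_anti i j h) (rowLen_eq_zero lam le_rfl)

theorem headD_parts (lam : YoungDiagram) : (parts lam).headD 0 = lam.rowLen 0 :=
  headD_rowList (rowLen_eq_zero lam le_rfl)

theorem psi_eq_psiProd {ν lam : YoungDiagram} (h : Interlaces ν lam) :
    psi ν lam = psiProd t (rowList ν.rowLen (lam.colLen 0 + 1)) (parts lam) := by
  rw [psiProd, finprod_eq_prod_of_mulSupport_subset (s := (Finset.Icc 1 (ν.rowLen 0)).map
    Nat.castEmbedding), Finset.prod_map, psi, J, Finset.prod_filter]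
  · refine Finset.prod_congr rfl fun j hj => ?_
    have hj1 := (Finset.mem_Icc.1 hj).1
    have skewCol_lt_iff : skewCol ν lam j < skewCol ν lam (j + 1) ↔
        0 < (j : ℤ) ∧ ν.rowLens.count j < lam.rowLens.count j := by
      have := count_rowLens_add_colLen ν hj1
      have := count_rowLens_add_colLen lam hj1
      rw [skewCol, skewCol, Nat.add_sub_cancel]
      omega
    rw [Nat.castEmbedding_apply, count_rowList_rowLen ν (colLen_le_of_interlaces h) hj1, parts,
      count_rowList_rowLen lam le_rfl hj1]
    simp only [skewCol_lt_iff]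
  · intro j hj
    have hcond := (ite_ne_right_iff.1 (Function.mem_mulSupport.1 hj)).1
    obtain ⟨i, -, rfl⟩ := List.mem_map.1 (List.count_pos_iff.1 hcond.2.pos)
    refine Finset.mem_coe.2 (Finset.mem_map.2 ⟨lam.rowLen i, Finset.mem_Icc.2 ⟨?_, ?_⟩, rfl⟩)
    · exact_mod_cast hcond.1
    · exact (lam.rowLen_anti 0 i i.zero_le).trans (h 0).1

end YoungDiagrams

section BottomPartition

theorem xTranslate_coupledQ_of_isEmpty {l' : ℕ} (α : Fin 0 → ℤ) (β : Fin l' → ℤ) :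
    xTranslate (coupledQ α β) = Polynomial.C (coupledQ α β) := by
  rw [coupledQ, map_finsum _ (term_support_finite α β), map_finsum _ (term_support_finite α β)]
  refine finsum_congr fun e => ?_
  rw [term, map_smul, ← Polynomial.smul_C]
  congr 1
  rw [qPair, Finset.univ_eq_empty, Finset.prod_empty, one_mul, map_prod, map_prod]
  exact Finset.prod_congr rfl fun a _ => map_q_of_fixed xTranslate_y _

theorem vertexOp_coupledQ_of_isEmpty {l' : ℕ} (α : Fin 0 → ℤ) (β : Fin l' → ℤ) (n : ℤ) :
    vertexOp n (coupledQ α β) = q xOp n (coupledQ α β) := by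
  have lsum_C := lsum_C_mul_X_pow (fun k => q xOp (n + k)) (coupledQ α β) 0
  rw [pow_zero, mul_one, Nat.cast_zero, add_zero] at lsum_C
  rw [vertexOp, LinearMap.comp_apply, AlgHom.toLinearMap_apply, xTranslate_coupledQ_of_isEmpty,
    lsum_C]

theorem coupledQ_eq_vertexOps {l l' : ℕ} (f : ℕ → ℕ) (β : Fin l' → ℤ) :
    coupledQ (fun i : Fin l => (f i : ℤ)) β = vertexOps (rowList f l) (coupledQ Fin.elim0 β) := by
  induction l generalizing f with
  | zero => exact congrArg (coupledQ · β) (Subsingleton.elim _ _)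
  | succ l ih =>
    rw [rowList_succ, vertexOps_cons, ← ih, ← coupledQ_cons]
    congr 1
    exact (Fin.cons_self_tail fun i : Fin (l + 1) => (f i : ℤ)).symm

theorem coupledQ_rows_eq_vertexOps (lam : YoungDiagram) {l' : ℕ} (β : Fin l' → ℤ) {k : ℕ}
    (hk : lam.colLen 0 ≤ k) :
    coupledQ (rows lam) β = vertexOps (rowList lam.rowLen k) (coupledQ Fin.elim0 β) := by
  have vertexOp_zero : vertexOp 0 (coupledQ Fin.elim0 β) = coupledQ Fin.elim0 β := by
    rw [vertexOp_coupledQ_of_isEmpty, q_zero, Module.End.one_apply]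
  obtain ⟨j, rfl⟩ := Nat.exists_eq_add_of_le hk
  rw [rowList_add (fun i hi => rowLen_eq_zero lam hi),
    vertexOps_append_replicate_zero vertexOp_zero]
  exact coupledQ_eq_vertexOps lam.rowLen β

end BottomPartition

section Pieri

/-- The rows of `ν` below the first one, where `ν` interlaces with `λ`, padded with a zero if `ν`
and `λ` have equally many rows. -/
def lowerRows (lam ν : YoungDiagram) : List ℤ :=
  rowList (fun i => ν.rowLen (i + 1)) (lam.colLen 0)

theorem lowerRows_mem_strips {ν lam : YoungDiagram} (h : Interlaces ν lam) :
    lowerRows lam ν ∈ strips (parts lam) :=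
  (rowList_mem_strips_iff _ (rowLen_eq_zero lam le_rfl)).2 fun i _ => ⟨(h (i + 1)).1, (h i).2⟩

theorem psi_eq_pieriCoeff {ν lam : YoungDiagram} (h : Interlaces ν lam) :
    psi ν lam = pieriCoeff t (parts lam) (lowerRows lam ν) (ν.rowLen 0) := by
  rw [psi_eq_psiProd h, rowList_succ, ← psiProd_cons_eq_pieriCoeff t (lowerRows_mem_strips h)
    (by rw [headD_parts]; exact_mod_cast (h 0).1)]
  rfl

theorem rowLen_zero_eq {ν lam : YoungDiagram} (h : Interlaces ν lam) :
    (ν.rowLen 0 : ℤ) = ν.card - lam.card + (parts lam).sum - (lowerRows lam ν).sum := by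
  have card_eq := card_eq_sum_rowLen ν (colLen_le_of_interlaces h)
  rw [Finset.sum_range_succ'] at card_eq
  rw [lowerRows, parts, sum_rowList, sum_rowList, ← card_eq_sum_rowLen lam le_rfl, card_eq]
  push_cast
  ring

theorem eq_of_lowerRows_eq {ν ν' lam : YoungDiagram} (h : Interlaces ν lam)
    (h' : Interlaces ν' lam) (hcard : ν.card = ν'.card)
    (hrows : lowerRows lam ν = lowerRows lam ν') : ν = ν' := by
  refine rowLen_injective (funext fun i => ?_)
  rcases i with _ | i
  · have first_row := rowLen_zero_eq h
    rw [hrows, hcard, ← rowLen_zero_eq h'] at first_row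
    exact_mod_cast first_row
  · by_cases hi : i < lam.colLen 0
    · exact eq_of_rowList_eq hrows hi
    · have := colLen_le_of_interlaces h
      have := colLen_le_of_interlaces h'
      rw [rowLen_eq_zero ν (by omega), rowLen_eq_zero ν' (by omega)]

theorem exists_interlaces_of_mem_strips {lam : YoungDiagram} {ρ : List ℤ}
    (hρ : ρ ∈ strips (parts lam)) {r : ℕ} (hr : lam.rowLen 0 ≤ r) :
    ∃ ν, Interlaces ν lam ∧ ν.rowLen 0 = r ∧ lowerRows lam ν = ρ := by
  have lam_vanishing := rowLen_eq_zero lam (le_refl (lam.colLen 0))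
  obtain ⟨g, g_vanishing, rfl⟩ := exists_rowList_of_mem_strips lam_vanishing hρ
  rw [parts, rowList_mem_strips_iff _ lam_vanishing] at hρ
  have interlacing (i : ℕ) : lam.rowLen (i + 1) ≤ g i ∧ g i ≤ lam.rowLen i := by
    by_cases hi : i < lam.colLen 0
    · exact hρ i hi
    · rw [g_vanishing i (by omega), rowLen_eq_zero lam (i := i + 1) (by omega)]
      exact ⟨le_rfl, Nat.zero_le _⟩
  obtain ⟨ν, hν, rowLen_eq⟩ := exists_interlaces (lam := lam)
    (f := fun i => Nat.casesOn i r g) <| by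
      rintro (_ | i)
      · exact ⟨hr, (interlacing 0).2⟩
      · exact ⟨(interlacing i).1, (interlacing (i + 1)).2⟩
  refine ⟨ν, hν, congrFun rowLen_eq 0, ?_⟩
  rw [lowerRows, rowLen_eq]

theorem bijOn_lowerRows (lam : YoungDiagram) (n : ℕ) :
    Set.BijOn (lowerRows lam) {ν | Interlaces ν lam ∧ ν.card = lam.card + n}
      {ρ | ρ ∈ strips (parts lam) ∧ (lam.rowLen 0 : ℤ) ≤ n + (parts lam).sum - ρ.sum} := by
  refine ⟨fun ν hν => ⟨lowerRows_mem_strips hν.1, ?_⟩,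
    fun ν hν ν' hν' => eq_of_lowerRows_eq hν.1 hν'.1 (hν.2.trans hν'.2.symm), ?_⟩
  · have first_row := rowLen_zero_eq hν.1
    rw [hν.2, Nat.cast_add, add_sub_cancel_left] at first_row
    rw [← first_row]
    exact_mod_cast (hν.1 0).1
  · rintro ρ ⟨hρ, hr⟩
    obtain ⟨r, first_row⟩ := Int.eq_ofNat_of_zero_le ((Nat.cast_nonneg _).trans hr)
    obtain ⟨ν, hν, rfl, rfl⟩ := exists_interlaces_of_mem_strips hρ (r := r) (by omega)
    have := rowLen_zero_eq hν
    exact ⟨ν, ⟨hν, by omega⟩, rfl⟩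

theorem finite_interlaces (lam : YoungDiagram) (n : ℕ) :
    {ν | Interlaces ν lam ∧ ν.card = lam.card + n}.Finite :=
  (bijOn_lowerRows lam n).finite_iff_finite.2
    ((strips (parts lam)).finite_toSet.subset fun _ hρ => hρ.1)

theorem q_xOp_coupledQ (lam : YoungDiagram) {l' : ℕ} (β : Fin l' → ℤ) (n : ℕ) :
    q xOp n (coupledQ (rows lam) β) =
      ∑ᶠ ν ∈ {ν | Interlaces ν lam ∧ ν.card = lam.card + n},
        psi ν lam • coupledQ (rows ν) β := by
  let a := parts lam
  let summand (ρ : List ℤ) : A := pieriCoeff t a ρ (n + a.sum - ρ.sum) •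
    vertexOps ((n + a.sum - ρ.sum) :: ρ) (coupledQ Fin.elim0 β)
  have summand_lowerRows (ν : YoungDiagram)
      (hν : ν ∈ {ν | Interlaces ν lam ∧ ν.card = lam.card + n}) :
      psi ν lam • coupledQ (rows ν) β = summand (lowerRows lam ν) := by
    have first_row := rowLen_zero_eq hν.1
    rw [hν.2, Nat.cast_add, add_sub_cancel_left] at first_row
    rw [psi_eq_pieriCoeff hν.1,
      coupledQ_rows_eq_vertexOps ν β (colLen_le_of_interlaces hν.1), rowList_succ, first_row]
    rfl
  have summand_eq_zero (ρ : List ℤ) (h : ¬(lam.rowLen 0 : ℤ) ≤ n + a.sum - ρ.sum) :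
      summand ρ = 0 := by
    simp only [summand]
    rw [pieriCoeff_of_lt t ρ (by rw [headD_parts]; exact not_le.1 h), zero_smul]
  rw [finsum_mem_eq_of_bijOn _ (bijOn_lowerRows lam n) summand_lowerRows,
    coupledQ_rows_eq_vertexOps lam β le_rfl, ← parts, q_xOp_vertexOps (isPartition_parts lam)
      (vertexOp_coupledQ_of_isEmpty _ β)]
  exact (finsum_cond_eq_sum_of_cond_iff summand fun hρ =>
    and_iff_left (not_imp_comm.1 (summand_eq_zero _) hρ)).symm

theorem coeff_scale (p : Polynomial K) (f : A) (n : ℕ) :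
    PowerSeries.coeff n (scale p f) = p.coeff n • f := by
  rw [scale, PowerSeries.coeff_mul_C, Polynomial.coeff_coe, Polynomial.coeff_map,
    Algebra.smul_def]

theorem coeff_scale_P {ν lam : YoungDiagram} (h : Interlaces ν lam) (f : A) (n : ℕ) :
    PowerSeries.coeff n (scale (P ν lam) f) =
      if ν.card = lam.card + n then psi ν lam • f else 0 := by
  have := card_le_of_interlaces h
  rw [coeff_scale, P, if_pos h, Polynomial.coeff_monomial, ite_smul, zero_smul]
  exact if_congr (by omega) rfl rfl

theorem coeff_act_Gamma1 (f : A) (n : ℕ) : PowerSeries.coeff n (act Gamma1 f) = q xOp n f := by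
  rw [act, PowerSeries.coeff_mk, q_natCast, Gamma1]

theorem isFormalSum_Gamma1 (lam mu : YoungDiagram) :
    IsFormalSum (fun ν : {ν : YoungDiagram // Interlaces ν lam} => scale (P ν lam) (Q ν mu))
      (act Gamma1 (Q lam mu)) := by
  classical
  intro n
  simp only [fun ν : {ν // Interlaces ν lam} => coeff_scale_P ν.2, coeff_act_Gamma1]
  constructor
  · refine ((finite_interlaces lam n).preimage Subtype.val_injective.injOn).subset fun ν hν => ?_
    exact ⟨ν.2, (ite_ne_right_iff.1 hν).1⟩
  · rw [finsum_subtype_eq_finsum_cond (fun ν => Interlaces ν lam)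
      (f := fun ν => if ν.card = lam.card + n then psi ν lam • Q ν mu else 0)]
    refine (q_xOp_coupledQ lam (rows mu) n).trans (finsum_congr fun ν => ?_)
    simp only [Set.mem_ofPred_eq, finsum_eq_if, ite_and]
    rfl

end Pieri

section Symmetry

/-- The automorphism of `ℚ(t)[x, y]` that exchanges `xₙ` and `yₙ`. -/
def swapXY : A ≃ₐ[K] A := MvPolynomial.renameEquiv K (Equiv.sumComm ℕ+ ℕ+)

theorem swapXY_x (n : ℕ+) : swapXY (x n) = y n := by
  simp [swapXY, x, y]

theorem swapXY_y (n : ℕ+) : swapXY (y n) = x n := by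
  simp [swapXY, x, y]

theorem swapXY_q_x (n : ℤ) : swapXY (q x n) = q y n := by
  simpa only [AlgEquiv.coe_toAlgHom, swapXY_x] using map_q (swapXY : A →ₐ[K] A) x n

theorem swapXY_q_y (n : ℤ) : swapXY (q y n) = q x n := by
  simpa only [AlgEquiv.coe_toAlgHom, swapXY_y] using map_q (swapXY : A →ₐ[K] A) y n

theorem swapXY_qPair {l l' : ℕ} (α : Fin l → ℤ) (β : Fin l' → ℤ) :
    swapXY (qPair α β) = qPair β α := by
  simp only [qPair, map_mul, map_prod, swapXY_q_x, swapXY_q_y, mul_comm]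

/-- The exponents of a term of the raising operator formula after the two index sequences have been
exchanged. -/
def swapExponents (l l' : ℕ) :
    (Pairs l → ℕ) × (Pairs l' → ℕ) × (Fin l × Fin l' → ℕ) ≃
      (Pairs l' → ℕ) × (Pairs l → ℕ) × (Fin l' × Fin l → ℕ) where
  toFun e := (e.2.1, e.1, e.2.2 ∘ Prod.swap)
  invFun e := (e.2.1, e.1, e.2.2 ∘ Prod.swap)
  left_inv _ := rfl
  right_inv _ := rfl

theorem lowerLeft_swap {l l' : ℕ} (d : Fin l × Fin l' → ℕ) (β : Fin l' → ℤ) :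
    lowerLeft (d ∘ Prod.swap) β = lowerRight d β := by
  rw [lowerLeft, lowerRight]
  congr 1
  exact Fintype.sum_equiv (Equiv.prodComm _ _) _ _ fun _ => rfl

theorem lowerRight_swap {l l' : ℕ} (d : Fin l × Fin l' → ℕ) (α : Fin l → ℤ) :
    lowerRight (d ∘ Prod.swap) α = lowerLeft d α :=
  (lowerLeft_swap (d ∘ Prod.swap) α).symm

theorem swapXY_term {l l' : ℕ} (α : Fin l → ℤ) (β : Fin l' → ℤ)
    (e : (Pairs l → ℕ) × (Pairs l' → ℕ) × (Fin l × Fin l' → ℕ)) :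
    swapXY (term α β e) = term β α (swapExponents l l' e) := by
  have prod_swap : ∏ p, lowerCoeff (e.2.2 p) = ∏ p, lowerCoeff ((e.2.2 ∘ Prod.swap) p) :=
    Fintype.prod_equiv (Equiv.prodComm _ _) _ _ fun _ => rfl
  simp only [term, swapExponents, Equiv.coe_fn_mk, map_smul, swapXY_qPair, lowerLeft_swap,
    lowerRight_swap, prod_swap]
  rw [mul_comm (∏ p, raiseCoeff (e.1 p))]

theorem swapXY_Q (lam mu : YoungDiagram) : swapXY (Q lam mu) = Q mu lam := by
  rw [Q, map_finsum _ (term_support_finite _ _), finsum_congr (swapXY_term (rows lam) (rows mu))]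
  exact finsum_comp_equiv (swapExponents (lam.colLen 0) (mu.colLen 0))
    (f := term (rows mu) (rows lam))

theorem swapXY_xOp (n : ℕ+) (f : A) : swapXY (xOp n f) = yOp n (swapXY f) := by
  have pderiv_swapXY : MvPolynomial.pderiv (Sum.inl n) (swapXY f) =
      swapXY (MvPolynomial.pderiv (Sum.inr n) f) :=
    MvPolynomial.pderiv_rename (Equiv.sumComm ℕ+ ℕ+).injective (x := Sum.inr n) (p := f)
  simp only [xOp, yOp, LinearMap.sub_apply, LinearMap.mulLeft_apply, LinearMap.smul_apply,
    Derivation.coeFn_coe, map_sub, map_mul, map_smul, swapXY_x, pderiv_swapXY]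

theorem swapXY_q_xOp (n : ℤ) (f : A) : swapXY (q xOp n f) = q yOp n (swapXY f) := by
  let conj := swapXY.toLinearEquiv.conjAlgEquiv K
  have conj_xOp (k : ℕ+) : conj (xOp k) = yOp k := LinearMap.ext fun g => by
    rw [← swapXY.apply_symm_apply g, ← swapXY_xOp]
    simp [conj, LinearEquiv.conjAlgEquiv_apply]
  have conj_q := map_q (conj : Module.End K A →ₐ[K] Module.End K A) xOp n
  simp only [AlgEquiv.coe_toAlgHom, conj_xOp] at conj_q
  rw [← conj_q]
  simp [conj, LinearEquiv.conjAlgEquiv_apply]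

theorem isFormalSum_Gamma2 (lam mu : YoungDiagram) :
    IsFormalSum (fun ν : {ν : YoungDiagram // Interlaces ν mu} => scale (P ν mu) (Q lam ν))
      (act Gamma2 (Q lam mu)) := by
  intro n
  have coeff_summand (ν : {ν : YoungDiagram // Interlaces ν mu}) :
      PowerSeries.coeff n (scale (P ν mu) (Q lam ν)) =
        swapXY (PowerSeries.coeff n (scale (P ν mu) (Q ν lam))) := by
    rw [coeff_scale, coeff_scale, map_smul, swapXY_Q]
  have coeff_act : PowerSeries.coeff n (act Gamma2 (Q lam mu)) =
      swapXY (PowerSeries.coeff n (act Gamma1 (Q mu lam))) := by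
    rw [coeff_act_Gamma1, swapXY_q_xOp, swapXY_Q, act, PowerSeries.coeff_mk, q_natCast, Gamma2]
  obtain ⟨finite_support, coeff_eq_finsum⟩ := isFormalSum_Gamma1 mu lam n
  simp only [coeff_summand, coeff_act]
  refine ⟨finite_support.subset fun ν hν h => hν ?_, ?_⟩
  · simp only [h, map_zero]
  · rw [coeff_eq_finsum, map_finsum _ finite_support]

end Symmetry

end CoupledHL

end

theorem mainTheorem3 (lam mu : YoungDiagram) :
    CoupledHL.IsFormalSum
        (fun nu : {nu : YoungDiagram // CoupledHL.Interlaces nu lam} =>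
          CoupledHL.scale (CoupledHL.P nu lam) (CoupledHL.Q nu mu))
        (CoupledHL.act CoupledHL.Gamma1 (CoupledHL.Q lam mu)) ∧
      CoupledHL.IsFormalSum
        (fun nu : {nu : YoungDiagram // CoupledHL.Interlaces nu mu} =>
          CoupledHL.scale (CoupledHL.P nu mu) (CoupledHL.Q lam nu))
        (CoupledHL.act CoupledHL.Gamma2 (CoupledHL.Q lam mu)) :=
  ⟨CoupledHL.isFormalSum_Gamma1 lam mu, CoupledHL.isFormalSum_Gamma2 lam mu⟩
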